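/- Let $r\ge 1$ and $0<\zeta_0<\zeta_1<\dots<\zeta_{r-1}<1$. For every vertex $a\in\mathbb N^{l}$, $0\le l\le r-1$, of the tree $\mathbb N^0\cup\mathbb N^1\cup\dots\cup\mathbb N^r$, let $u_{a1}>u_{a2}>\cdots$ be the decreasing enumeration of a Poisson process on $(0,\infty)$ with mean measure $\zeta_{l}x^{-1-\zeta_{l}}dx$, these processes being independent for different $a$. For $\alpha\in\mathbb N^r$ let $p(\alpha)=\{\alpha_1,(\alpha_1,\alpha_2),\dots,(\alpha_1,\dots,\alpha_r)\}$, $w_\alpha=\prod_{\beta\in p(\alpha)}u_\beta$ and $\nu_\alpha=w_\alpha/\sum_{\beta\in\mathbb N^r}w_\beta$; the $(\nu_\alpha)$ are the random weights of the Ruelle probability cascade (RPC) with parameters $\zeta$. Let $(\omega_\beta)$, indexed by the vertices other than the root, be i.i.d. uniform on $[0,1]$ and independent of the RPC, and let $\Omega_\alpha=(\omega_\beta)_{\beta\in p(\alpha)}$. Let $X_r:[0,1]^r\to\mathbb R$ be measurable with $\mathbb E\exp(\zeta_{r-1}X_r(\omega_1,\dots,\omega_r))<\infty$ for i.i.d.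 uniform $\omega_1,\dots,\omega_r$ on $[0,1]$. Then, almost surely, $\sum_\alpha w_\alpha<\infty$ and $\sum_\alpha\nu_\alpha\exp X_r(\Omega_\alpha)<\infty$, the random variable $$\phi_r=\log\sum_{\alpha\in\mathbb N^r}\nu_\alpha\exp X_r(\Omega_\alpha)$$ is square integrable, and $$\mathbb E\,(\phi_r-\mathbb E\,\phi_r)^2\le 4\,c(\zeta_0),$$ where $c(\zeta_0)$ is a finite constant that depends only on $\zeta_0$; in particular it does not depend on the function $X_r$ or its distribution. -/

import Mathlib

open MeasureTheory ProbabilityTheory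
open scoped ENNReal

/-- A random set `N` is a Poisson (point) process with mean measure `μ`: it is a.s. countable, the
number of its points in a measurable set of finite mean measure is Poisson distributed with the mean
given by `μ`, and the numbers of points in finitely many pairwise disjoint measurable sets are
independent. -/
structure IsPoissonProcess {Ω S : Type*} [MeasurableSpace Ω] [MeasurableSpace S]
    (μ : Measure S) (N : Ω → Set S) (P : Measure Ω) : Prop where
  countable : ∀ᵐ ω ∂P, (N ω).Countable
  hasLaw_encard : ∀ B : Set S, MeasurableSet B → μ B ≠ ∞ →
    HasLaw (fun ω => (N ω ∩ B).encard)
      ((poissonMeasure (μ B).toNNReal).map (fun k : ℕ => (k : ℕ∞))) P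
  iIndepFun_encard : ∀ (n : ℕ) (B : Fin n → Set S), (∀ i, MeasurableSet (B i)) →
    Pairwise (fun i j => Disjoint (B i) (B j)) →
    iIndepFun (fun i ω => (N ω ∩ B i).encard) P

/-- The measure `s x ^ (-1 - s) dx` on `(0, ∞)`. -/
noncomputable def stableIntensity (s : ℝ) : Measure ℝ :=
  (volume.restrict (Set.Ioi 0)).withDensity (fun x => ENNReal.ofReal (s * x ^ (-1 - s)))

/-- The vertices `a ∈ ℕ^l`, `l < r`, of the tree `ℕ^0 ∪ ℕ^1 ∪ ⋯ ∪ ℕ^r` that are not leaves; the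
children of such a vertex `a` are the vertices `a n = (a, n)` for `n : ℕ`. So every vertex other
than the root is a pair: a vertex in `InnerVertex r` and the number of a child of it. -/
abbrev InnerVertex (r : ℕ) : Type := Σ l : Fin r, (Fin l → ℕ)

/-- The ancestor `(α₁, …, α_l) ∈ ℕ^l` of the leaf `α = (α₁, …, α_r)`. The next vertex on the path
from the root to `α` is child number `α l` of it (with coordinates of `α` numbered from `0`). -/
def ancestor {r : ℕ} (α : Fin r → ℕ) (l : Fin r) : InnerVertex r :=
  ⟨l, fun i => α (Fin.castLE l.isLt.le i)⟩

/-- `u a n` is the variable attached to the vertex `a n` in the construction of the Ruelle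
probability cascade with parameters `ζ`: independently for all inner vertices `a`, the sequence
`u a 0 > u a 1 > ⋯` is the decreasing enumeration of a Poisson process on `(0, ∞)` with mean measure
`ζ_{|a|} x ^ (-1 - ζ_{|a|}) dx`. -/
structure IsCascadePoints {Ω : Type*} [MeasurableSpace Ω] {r : ℕ} (ζ : Fin r → ℝ)
    (u : InnerVertex r → ℕ → Ω → ℝ) (P : Measure Ω) : Prop where
  measurable : ∀ a n, Measurable (u a n)
  strictAnti : ∀ a, ∀ᵐ ω ∂P, StrictAnti (fun n => u a n ω)
  isPoissonProcess : ∀ a : InnerVertex r,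
    IsPoissonProcess (stableIntensity (ζ a.1)) (fun ω => Set.range (fun n => u a n ω)) P
  iIndepFun : iIndepFun (fun (a : InnerVertex r) (ω : Ω) (n : ℕ) => u a n ω) P

/-- `w_α`, the product of the points `u` over the path from the root to the leaf `α`. -/
noncomputable def cascadeProd {Ω : Type*} {r : ℕ} (u : InnerVertex r → ℕ → Ω → ℝ)
    (α : Fin r → ℕ) (ω : Ω) : ℝ :=
  ∏ l : Fin r, u (ancestor α l) (α l) ω

/-- The random weights `ν_α = w_α / ∑_β w_β` of the Ruelle probability cascade. -/
noncomputable def cascadeWeight {Ω : Type*} {r : ℕ} (u : InnerVertex r → ℕ → Ω → ℝ)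
    (α : Fin r → ℕ) (ω : Ω) : ℝ :=
  cascadeProd u α ω / ∑' β : Fin r → ℕ, cascadeProd u β ω

/-- The marks `Ω_α` along the path from the root to the leaf `α`. -/
def pathMarks {Ω : Type*} {r : ℕ} (U : InnerVertex r → ℕ → Ω → unitInterval)
    (α : Fin r → ℕ) (ω : Ω) : Fin r → unitInterval :=
  fun l => U (ancestor α l) (α l) ω

/-- `φ_r = log ∑_α ν_α exp X_r(Ω_α)`. -/
noncomputable def cascadePhi {Ω : Type*} {r : ℕ} (u : InnerVertex r → ℕ → Ω → ℝ)
    (U : InnerVertex r → ℕ → Ω → unitInterval) (X : (Fin r → unitInterval) → ℝ) (ω : Ω) : ℝ :=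
  Real.log (∑' α : Fin r → ℕ, cascadeWeight u α ω * Real.exp (X (pathMarks U α ω)))

/-! Write `φ = log T - log Z` with `T = ∑ w_α exp X(Ω_α)` and `Z = ∑ w_α`. Both sums are, up to a
deterministic scale, one-sided stable variables of index `ζ₀`, so the logarithm of each is a
constant plus a variable whose second moment is bounded in terms of `ζ₀` alone. The function `X`
enters only through the scale, and the variance does not see the resulting shift.

Stability comes from integrating the tree out from the leaves to the root
(`exists_laplace_cascade`). At one vertex, the Laplace functional of a Poisson process and the
scaling of `x ^ (-1 - ζ) dx` turn `∑ₙ k(Uₙ) (θ uₙ) ^ s` into the exponent `C θ ^ ζ`, where `C` is a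
constant times `E k(U) ^ (ζ / s)` (`lintegral_expNeg_marked_stable`). Independence across the
vertices of a level gives a sum of the same shape one level up, with exponent `ζ` in place of `s`
(`lintegral_expNeg_level`). At the root, `E exp (-t T) = exp (-c t ^ ζ₀)`.

After rescaling to `c = 1`, this transform determines a small positive moment and the moment of
order `-1`, which together dominate the squared logarithm (`exists_lintegral_sq_log_sub_le`).
Working in `[0, ∞]` lets the transforms be computed before any sum is known to converge; finiteness
and positivity then follow from these moments. -/

/-! ### The exponential `exp (-x)` on `[0, ∞]`. -/

/-- The function `x ↦ exp (-x)` on `[0, ∞]`, with the value `0` at `∞`. -/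
noncomputable def expNeg (x : ℝ≥0∞) : ℝ≥0∞ := EReal.exp (-(x : EReal))

/-- An inverse of `expNeg` on `[0, 1]`. -/
noncomputable def negLog (p : ℝ≥0∞) : ℝ≥0∞ := (-(ENNReal.log p)).toENNReal

@[simp] theorem expNeg_zero : expNeg 0 = 1 := by simp [expNeg]

@[simp] theorem expNeg_top : expNeg ∞ = 0 := by simp [expNeg]

theorem expNeg_ofReal {x : ℝ} (hx : 0 ≤ x) :
    expNeg (ENNReal.ofReal x) = ENNReal.ofReal (Real.exp (-x)) := by
  rw [expNeg, EReal.coe_ennreal_ofReal, max_eq_left hx, ← EReal.coe_neg, EReal.exp_coe]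

theorem expNeg_eq {x : ℝ≥0∞} (hx : x ≠ ∞) :
    expNeg x = ENNReal.ofReal (Real.exp (-x.toReal)) := by
  rw [← expNeg_ofReal ENNReal.toReal_nonneg, ENNReal.ofReal_toReal hx]

theorem expNeg_add (x y : ℝ≥0∞) : expNeg (x + y) = expNeg x * expNeg y := by
  rw [expNeg, expNeg, expNeg, EReal.coe_ennreal_add, EReal.neg_add, sub_eq_add_neg, EReal.exp_add]
  · left; exact EReal.coe_ennreal_ne_bot x
  · right; exact EReal.coe_ennreal_ne_bot y

theorem expNeg_antitone : Antitone expNeg := fun x y h => by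
  rw [expNeg, expNeg, EReal.exp_le_exp_iff, EReal.neg_le_neg_iff]
  exact_mod_cast h

theorem expNeg_le_one (x : ℝ≥0∞) : expNeg x ≤ 1 := by
  simpa using expNeg_antitone (zero_le (a := x))

theorem expNeg_ne_top (x : ℝ≥0∞) : expNeg x ≠ ∞ := ((expNeg_le_one x).trans_lt ENNReal.one_lt_top).ne

theorem continuous_expNeg : Continuous expNeg := by
  unfold expNeg
  exact ENNReal.continuous_exp.comp (continuous_neg.comp continuous_coe_ennreal_ereal)

@[fun_prop] theorem measurable_expNeg : Measurable expNeg := continuous_expNeg.measurable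

theorem expNeg_injective : Function.Injective expNeg := fun x y h => by
  have := EReal.exp_strictMono.injective h
  simpa using this

theorem expNeg_negLog {p : ℝ≥0∞} (hp : p ≤ 1) : expNeg (negLog p) = p := by
  rw [expNeg, negLog, EReal.coe_toENNReal, neg_neg, ENNReal.exp_log]
  rw [EReal.le_neg, neg_zero]
  exact ENNReal.log_le_zero_iff.2 hp

@[fun_prop] theorem measurable_negLog : Measurable negLog := by
  unfold negLog
  exact measurable_ereal_toENNReal.comp (continuous_neg.measurable.comp ENNReal.measurable_log)

theorem expNeg_sum {ι : Type*} (s : Finset ι) (f : ι → ℝ≥0∞) :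
    expNeg (∑ i ∈ s, f i) = ∏ i ∈ s, expNeg (f i) := by
  classical
  induction s using Finset.induction_on with
  | empty => simp
  | insert i s hi ih => rw [Finset.sum_insert hi, Finset.prod_insert hi, expNeg_add, ih]

theorem tendsto_expNeg_sum {ι : Type*} (f : ι → ℝ≥0∞) :
    Filter.Tendsto (fun s : Finset ι => expNeg (∑ i ∈ s, f i)) Filter.atTop
      (nhds (expNeg (∑' i, f i))) :=
  (continuous_expNeg.tendsto _).comp ENNReal.summable.hasSum

theorem one_sub_expNeg_le (x : ℝ≥0∞) : 1 - expNeg x ≤ x := by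
  rcases eq_or_ne x ∞ with rfl | hx
  · simp
  · rw [expNeg_eq hx, ← ENNReal.ofReal_one, ← ENNReal.ofReal_sub _ (Real.exp_pos _).le]
    refine ENNReal.ofReal_le_of_le_toReal ?_
    linarith [Real.add_one_le_exp (-x.toReal)]

theorem expNeg_lt_one {x : ℝ≥0∞} (hx : x ≠ 0) : expNeg x < 1 :=
  lt_of_le_of_ne (expNeg_le_one x) fun h => hx (expNeg_injective (h.trans expNeg_zero.symm))

/-! ### The stable intensity: finiteness and scaling. -/

theorem lintegral_stableIntensity (a : ℝ) {f : ℝ → ℝ≥0∞} (hf : Measurable f) :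
    ∫⁻ x, f x ∂stableIntensity a
      = ∫⁻ x in Set.Ioi (0 : ℝ), ENNReal.ofReal (a * x ^ (-1 - a)) * f x := by
  rw [stableIntensity, lintegral_withDensity_eq_lintegral_mul₀ (by fun_prop) hf.aemeasurable]
  rfl

/-- The constant in the Laplace exponent of the points, raised to the power `s`, of a Poisson
process with mean measure `stableIntensity a`. -/
noncomputable def stableConst (a s : ℝ) : ℝ≥0∞ :=
  ∫⁻ x, (1 - expNeg (ENNReal.ofReal x ^ s)) ∂stableIntensity a

theorem stableIntensity_Ioi {a : ℝ} (ha : 0 < a) {e : ℝ} (he : 0 < e) :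
    stableIntensity a (Set.Ioi e) = ENNReal.ofReal (e ^ (-a)) := by
  rw [← lintegral_indicator_one measurableSet_Ioi,
    lintegral_stableIntensity _ (measurable_one.indicator measurableSet_Ioi)]
  have h1 : ∀ x, ENNReal.ofReal (a * x ^ (-1 - a)) * (Set.Ioi e).indicator (1 : ℝ → ℝ≥0∞) x
      = (Set.Ioi e).indicator (fun x => ENNReal.ofReal (a * x ^ (-1 - a))) x := fun x => by
    by_cases h : x ∈ Set.Ioi e <;> simp [h]
  simp_rw [h1]
  rw [lintegral_indicator measurableSet_Ioi, Measure.restrict_restrict measurableSet_Ioi,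
    Set.inter_eq_left.2 (Set.Ioi_subset_Ioi he.le), ← ofReal_integral_eq_lintegral_ofReal,
    integral_const_mul, integral_Ioi_rpow_of_lt (by linarith) he]
  · congr 1
    rw [show -1 - a + 1 = -a by ring]
    field_simp
  · exact (integrableOn_Ioi_rpow_of_lt (by linarith) he).const_mul a
  · filter_upwards [ae_restrict_mem measurableSet_Ioi] with x hx
    have : 0 < x := he.trans hx
    positivity

/-- Near `0` the integrand is at most `x ^ s`, integrable against `x ^ (-1 - a)` because `a < s`;
beyond `1` it is at most `1` and the tail has finite mass. This is where the strict increase of `ζ`,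
and `ζ_{r-1} < 1`, are needed. -/
theorem stableConst_ne_top {a s : ℝ} (ha : 0 < a) (has : a < s) : stableConst a s ≠ ∞ := by
  have h0 : stableIntensity a (Set.Ioc 0 1)ᶜ = stableIntensity a (Set.Ioi 1) := by
    refine measure_congr ?_
    have : ∀ᵐ x ∂stableIntensity a, x ∈ Set.Ioi (0 : ℝ) :=
      (withDensity_absolutelyContinuous _ _).ae_le (ae_restrict_mem measurableSet_Ioi)
    filter_upwards [this] with x hx
    simp only [Set.mem_Ioi] at hx
    apply propext
    change (x ∈ (Set.Ioc 0 1)ᶜ) ↔ x ∈ Set.Ioi 1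
    simp [hx]
  rw [stableConst, ← lintegral_add_compl _ (measurableSet_Ioc (a := (0 : ℝ)) (b := 1))]
  refine ENNReal.add_ne_top.2 ⟨?_, ?_⟩
  · refine ne_top_of_le_ne_top ?_ (lintegral_mono fun x => one_sub_expNeg_le _)
    rw [← lintegral_indicator measurableSet_Ioc, lintegral_stableIntensity _
      (Measurable.indicator (by fun_prop) measurableSet_Ioc)]
    have h1 : ∫⁻ x in Set.Ioc (0 : ℝ) 1, ENNReal.ofReal (a * x ^ (s - 1 - a)) ≠ ∞ := by
      have : IntegrableOn (fun x : ℝ => a * x ^ (s - 1 - a)) (Set.Ioc 0 1) := by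
        have := (intervalIntegral.intervalIntegrable_rpow' (a := 0) (b := 1)
          (show -1 < s - 1 - a by linarith)).1
        exact this.const_mul a
      exact this.lintegral_lt_top.ne
    refine ne_top_of_le_ne_top h1 ?_
    rw [← lintegral_indicator measurableSet_Ioc, ← lintegral_indicator measurableSet_Ioi]
    refine lintegral_mono fun x => ?_
    by_cases hx : x ∈ Set.Ioc (0 : ℝ) 1
    · have hx0 : x ∈ Set.Ioi (0 : ℝ) := hx.1
      rw [Set.indicator_of_mem hx0, Set.indicator_of_mem hx, Set.indicator_of_mem hx,
        ENNReal.ofReal_rpow_of_pos hx.1, ← ENNReal.ofReal_mul (by have := hx.1; positivity),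
        mul_assoc, ← Real.rpow_add hx.1]
      exact le_of_eq (by ring_nf)
    · rw [Set.indicator_of_notMem hx]
      by_cases hx0 : x ∈ Set.Ioi (0 : ℝ)
      · rw [Set.indicator_of_mem hx0, Set.indicator_of_notMem hx, mul_zero]
      · rw [Set.indicator_of_notMem hx0]
  · refine ne_top_of_le_ne_top ?_ (lintegral_mono fun x => tsub_le_self)
    rw [setLIntegral_one, h0, stableIntensity_Ioi ha one_pos]
    exact ENNReal.ofReal_ne_top

theorem stableIntensity_Iic (a : ℝ) : stableIntensity a (Set.Iic 0) = 0 := by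
  refine withDensity_absolutelyContinuous _ _ ?_
  rw [Measure.restrict_apply measurableSet_Iic, Set.Iic_inter_Ioi, Set.Ioc_self, measure_empty]

theorem ae_stableIntensity_pos (a : ℝ) : ∀ᵐ x ∂stableIntensity a, 0 < x :=
  (withDensity_absolutelyContinuous _ _).ae_le (ae_restrict_mem measurableSet_Ioi)

theorem stableIntensity_univ {a : ℝ} (ha : 0 < a) : stableIntensity a Set.univ = ∞ := by
  have h : ∀ n : ℕ, ENNReal.ofReal n ≤ stableIntensity a Set.univ := fun n => by
    rcases n.eq_zero_or_pos with rfl | hn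
    · simp
    have hn : (0 : ℝ) < n := by exact_mod_cast hn
    refine le_trans (le_of_eq ?_)
      (measure_mono (Set.subset_univ (Set.Ioi ((n : ℝ) ^ (-1 / a)))))
    rw [stableIntensity_Ioi ha (Real.rpow_pos_of_pos hn _), ← Real.rpow_mul hn.le]
    congr 1
    rw [show -1 / a * -a = 1 by field_simp, Real.rpow_one]
  refine ENNReal.eq_top_of_forall_nnreal_le fun q => ?_
  obtain ⟨n, hn⟩ := exists_nat_ge q
  refine le_trans ?_ (h n)
  rw [ENNReal.ofReal_natCast]
  exact_mod_cast hn

theorem stableConst_pos {a : ℝ} (ha : 0 < a) (s : ℝ) : 0 < stableConst a s := by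
  rw [pos_iff_ne_zero, stableConst, Ne, lintegral_eq_zero_iff (by fun_prop)]
  intro h
  have : ∀ᵐ x ∂stableIntensity a, False := by
    filter_upwards [h, ae_stableIntensity_pos a] with x hx hx0
    rw [Pi.zero_apply, tsub_eq_zero_iff_le] at hx
    refine absurd (expNeg_lt_one ?_) hx.not_gt
    rw [ENNReal.ofReal_rpow_of_pos hx0]
    simpa using Real.rpow_pos_of_pos hx0 s
  have h2 : stableIntensity a Set.univ = 0 := by simpa [ae_iff] using this
  simp [stableIntensity_univ ha] at h2

theorem lintegral_stableIntensity_comp_mul (a : ℝ) {d : ℝ} (hd : 0 < d) {f : ℝ → ℝ≥0∞}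
    (hf : Measurable f) :
    ∫⁻ x, f (d * x) ∂stableIntensity a
      = ENNReal.ofReal (d ^ a) * ∫⁻ x, f x ∂stableIntensity a := by
  rw [lintegral_stableIntensity _ (by fun_prop), lintegral_stableIntensity _ hf,
    ← lintegral_const_mul _ (by fun_prop)]
  have h := lintegral_image_eq_lintegral_abs_deriv_mul (s := Set.Ioi (0 : ℝ)) (f := fun x => d * x)
    (f' := fun _ => d) measurableSet_Ioi (fun x _ => by
      simpa using ((hasDerivAt_id x).const_mul d).hasDerivWithinAt)
    (fun x _ y _ h => mul_left_cancel₀ hd.ne' h)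
    (fun x => ENNReal.ofReal (d ^ a) * (ENNReal.ofReal (a * x ^ (-1 - a)) * f x))
  have himg : (fun x => d * x) '' Set.Ioi (0 : ℝ) = Set.Ioi 0 := by
    ext y
    constructor
    · rintro ⟨x, hx, rfl⟩
      exact mul_pos hd hx
    · intro hy
      exact ⟨y / d, div_pos hy hd, by field_simp⟩
  rw [himg] at h
  rw [h]
  refine setLIntegral_congr_fun measurableSet_Ioi fun x hx => ?_
  have hx : 0 < x := hx
  rw [abs_of_pos hd, ← mul_assoc, ← mul_assoc, ← ENNReal.ofReal_mul hd.le,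
    ← ENNReal.ofReal_mul (by positivity), Real.mul_rpow hd.le hx.le]
  congr 2
  have : d * d ^ a * d ^ (-1 - a) = 1 := by
    rw [mul_assoc, ← Real.rpow_add hd]
    ring_nf
    rw [Real.rpow_neg_one]
    field_simp
  linear_combination (-(a * x ^ (-1 - a))) * this

theorem lintegral_one_sub_expNeg_mul_rpow {a s : ℝ} (ha : 0 < a) (hs : 0 < s) (c : ℝ≥0∞) :
    ∫⁻ x, (1 - expNeg (c * ENNReal.ofReal x ^ s)) ∂stableIntensity a
      = c ^ (a / s) * stableConst a s := by
  have has : 0 < a / s := by positivity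
  rcases eq_or_ne c 0 with rfl | h0
  · simp [ENNReal.zero_rpow_of_pos has]
  rcases eq_or_ne c ∞ with rfl | ht
  · rw [ENNReal.top_rpow_of_pos has, ENNReal.top_mul (stableConst_pos ha s).ne']
    refine Eq.trans ?_ ((lintegral_one (μ := stableIntensity a)).trans (stableIntensity_univ ha))
    refine lintegral_congr_ae ?_
    filter_upwards [ae_stableIntensity_pos a] with x hx
    have : ENNReal.ofReal x ^ s ≠ 0 := by
      rw [ENNReal.ofReal_rpow_of_pos hx]
      simpa using Real.rpow_pos_of_pos hx s
    simp [ENNReal.top_mul this]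
  have hc : 0 < c.toReal := ENNReal.toReal_pos h0 ht
  have hd : 0 < c.toReal ^ (1 / s) := by positivity
  have key := lintegral_stableIntensity_comp_mul a hd
    (f := fun x => 1 - expNeg (ENNReal.ofReal x ^ s)) (by fun_prop)
  rw [stableConst, show c ^ (a / s) = ENNReal.ofReal ((c.toReal ^ (1 / s)) ^ a) by
    rw [← Real.rpow_mul hc.le, ← ENNReal.ofReal_rpow_of_pos hc, ENNReal.ofReal_toReal ht]
    ring_nf, ← key]
  refine lintegral_congr fun x => ?_
  rw [ENNReal.ofReal_mul hd.le, ENNReal.mul_rpow_of_nonneg _ _ hs.le,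
    ENNReal.ofReal_rpow_of_pos hd, ← Real.rpow_mul hc.le, one_div, inv_mul_cancel₀ hs.ne',
    Real.rpow_one, ENNReal.ofReal_toReal ht]

/-! ### Laplace functional of a Poisson process. -/

theorem expNeg_mul_natCast (c : ℝ≥0∞) (k : ℕ) : expNeg (c * k) = expNeg c ^ k := by
  have := expNeg_sum (Finset.range k) (fun _ => c)
  simpa [mul_comm] using this

theorem lintegral_expNeg_mul_poissonMeasure (m : NNReal) (c : ℝ≥0∞) :
    ∫⁻ k : ℕ, expNeg (c * k) ∂poissonMeasure m = expNeg (m * (1 - expNeg c)) := by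
  set q := (expNeg c).toReal with hq
  have hqc : expNeg c = ENNReal.ofReal q := (ENNReal.ofReal_toReal (expNeg_ne_top c)).symm
  have hq0 : 0 ≤ q := ENNReal.toReal_nonneg
  have hq1 : q ≤ 1 := ENNReal.toReal_le_of_le_ofReal zero_le_one (by simpa using expNeg_le_one c)
  rw [poissonMeasure, lintegral_sum_measure]
  simp_rw [lintegral_smul_measure, lintegral_dirac, expNeg_mul_natCast, hqc, smul_eq_mul]
  have h1 : ∀ n : ℕ, ENNReal.ofReal (Real.exp (-m) * m ^ n / n.factorial) * ENNReal.ofReal q ^ n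
      = ENNReal.ofReal (Real.exp (-m) * ((m * q) ^ n / n.factorial)) := fun n => by
    rw [← ENNReal.ofReal_pow hq0, ← ENNReal.ofReal_mul (by positivity), mul_pow]
    ring_nf
  have h2 : HasSum (fun n : ℕ => Real.exp (-m) * ((m * q) ^ n / n.factorial))
      (Real.exp (-m) * Real.exp (m * q)) := by
    rw [Real.exp_eq_exp_ℝ]
    exact (NormedSpace.expSeries_div_hasSum_exp ((m : ℝ) * q)).mul_left _
  simp_rw [h1]
  rw [← ENNReal.ofReal_tsum_of_nonneg (fun n => by positivity) h2.summable, h2.tsum_eq,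
    ← ENNReal.ofReal_one, ← ENNReal.ofReal_sub _ hq0, ← ENNReal.ofReal_coe_nnreal,
    ← ENNReal.ofReal_mul m.coe_nonneg, expNeg_ofReal (mul_nonneg m.coe_nonneg (by linarith)),
    ← Real.exp_add]
  congr 2
  ring

/-- Injectivity is essential: the Poisson hypothesis speaks of the range as a set, which forgets
multiplicities. -/
theorem tsum_indicator_eq_encard {S : Type*} {x : ℕ → S} (hx : Function.Injective x) (B : Set S) :
    ∑' n, B.indicator (1 : S → ℝ≥0∞) (x n) = ((Set.range x ∩ B).encard : ℝ≥0∞) := by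
  have h1 : ∀ n, B.indicator (1 : S → ℝ≥0∞) (x n) = (x ⁻¹' B).indicator (fun _ => 1) n :=
    fun n => by by_cases h : x n ∈ B <;> simp [h]
  simp_rw [h1]
  rw [← tsum_subtype, ENNReal.tsum_set_one, ← hx.encard_image, Set.image_preimage_eq_inter_range,
    Set.inter_comm]

section Poisson

variable {Ω S : Type*} [MeasurableSpace Ω] [MeasurableSpace S] {P : Measure Ω}
  {μ : Measure S} {u : ℕ → Ω → S}

theorem lintegral_expNeg_count (hinj : ∀ᵐ ω ∂P, Function.Injective (fun n => u n ω))
    (hP : IsPoissonProcess μ (fun ω => Set.range (fun n => u n ω)) P) {B : Set S}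
    (hB : MeasurableSet B) (hBμ : μ B ≠ ∞) (c : ℝ≥0∞) :
    ∫⁻ ω, expNeg (c * ∑' n, B.indicator (1 : S → ℝ≥0∞) (u n ω)) ∂P
      = expNeg (μ B * (1 - expNeg c)) := by
  have hl := hP.hasLaw_encard B hB hBμ
  calc ∫⁻ ω, expNeg (c * ∑' n, B.indicator (1 : S → ℝ≥0∞) (u n ω)) ∂P
      = ∫⁻ ω, (fun k : ℕ∞ => expNeg (c * (k : ℝ≥0∞)))
          ((Set.range (fun n => u n ω) ∩ B).encard) ∂P := by
        refine lintegral_congr_ae ?_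
        filter_upwards [hinj] with ω hω
        rw [tsum_indicator_eq_encard hω B]
    _ = ∫⁻ k, expNeg (c * (k : ℝ≥0∞))
          ∂((poissonMeasure (μ B).toNNReal).map (fun k : ℕ => (k : ℕ∞))) := by
        rw [← hl.map_eq, lintegral_map' (by fun_prop) hl.aemeasurable]
    _ = _ := by
        rw [lintegral_map (by fun_prop) (by fun_prop)]
        simp only [ENat.toENNReal_coe]
        rw [lintegral_expNeg_mul_poissonMeasure, ENNReal.coe_toNNReal hBμ]

/-- The level sets of `g` at nonzero values are disjoint, so the sum is a linear combination of
independent Poisson counts. The level `0` contributes nothing and may have infinite measure. -/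
theorem lintegral_expNeg_sum_simpleFunc (hu : ∀ n, Measurable (u n))
    (hinj : ∀ᵐ ω ∂P, Function.Injective (fun n => u n ω))
    (hP : IsPoissonProcess μ (fun ω => Set.range (fun n => u n ω)) P) (g : SimpleFunc S ℝ≥0∞)
    (hg : ∀ c, c ≠ 0 → μ (g ⁻¹' {c}) ≠ ∞) :
    ∫⁻ ω, expNeg (∑' n, g (u n ω)) ∂P = expNeg (∫⁻ x, (1 - expNeg (g x)) ∂μ) := by
  classical
  let R := g.range.filter (· ≠ 0)
  let e := R.equivFin
  let C : Fin R.card → ℝ≥0∞ := fun i => (e.symm i : ℝ≥0∞)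
  let B : Fin R.card → Set S := fun i => g ⁻¹' {C i}
  have hC0 : ∀ i, C i ≠ 0 := fun i => (Finset.mem_filter.1 (e.symm i).2).2
  have hBm : ∀ i, MeasurableSet (B i) := fun i => g.measurableSet_preimage _
  have hBd : Pairwise fun i j => Disjoint (B i) (B j) := fun i j hij => by
    refine Disjoint.preimage _ (Set.disjoint_singleton.2 fun h => hij ?_)
    exact e.symm.injective (Subtype.ext h)
  -- Used with `φ = id` for the sum over the points and with `φ y = 1 - expNeg y` for the integral
  -- against `μ`.
  have hsum : ∀ (φ : ℝ≥0∞ → ℝ≥0∞), φ 0 = 0 → ∀ x,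
      φ (g x) = ∑ i, φ (C i) * (B i).indicator (1 : S → ℝ≥0∞) x := fun φ hφ x => by
    by_cases hx : g x = 0
    · rw [hx, hφ, Finset.sum_eq_zero fun i _ => ?_]
      have : x ∉ B i := fun h => hC0 i (h.symm.trans hx)
      simp [this]
    · have hxR : g x ∈ R := Finset.mem_filter.2 ⟨g.mem_range_self x, hx⟩
      have hCe : C (e ⟨g x, hxR⟩) = g x := by simp [C]
      rw [Finset.sum_eq_single (e ⟨g x, hxR⟩)]
      · have : x ∈ B (e ⟨g x, hxR⟩) := hCe.symm
        simp [this, hCe]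
      · intro i _ hi
        have : x ∉ B i := fun h => hi (by
          have h : g x = C i := h
          have : (⟨g x, hxR⟩ : R) = e.symm i := Subtype.ext h
          rw [this, Equiv.apply_symm_apply])
        simp [this]
      · simp
  let V : Fin R.card → Ω → ℝ≥0∞ := fun i ω =>
    expNeg (C i * ∑' n, (B i).indicator (1 : S → ℝ≥0∞) (u n ω))
  have hVm : ∀ i, Measurable (V i) := fun i => by
    have : Measurable fun ω => ∑' n, (B i).indicator (1 : S → ℝ≥0∞) (u n ω) :=
      Measurable.tsum fun n => (measurable_one.indicator (hBm i)).comp (hu n)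
    fun_prop
  have hind : iIndepFun V P := by
    have h := (hP.iIndepFun_encard _ B hBm hBd).comp
      (fun i (k : ℕ∞) => expNeg (C i * (k : ℝ≥0∞))) (fun i => by fun_prop)
    refine (iIndepFun_congr fun i => ?_).2 h
    filter_upwards [hinj] with ω hω
    simp only [V, Function.comp]
    rw [tsum_indicator_eq_encard hω]
  calc ∫⁻ ω, expNeg (∑' n, g (u n ω)) ∂P = ∫⁻ ω, ∏ i, V i ω ∂P := by
        refine lintegral_congr fun ω => ?_
        rw [← expNeg_sum]
        congr 1
        simp_rw [← ENNReal.tsum_mul_left]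
        rw [← Summable.tsum_finsetSum fun _ _ => ENNReal.summable]
        exact tsum_congr fun n => hsum id rfl _
    _ = ∏ i, ∫⁻ ω, V i ω ∂P := lintegral_prod_eq_prod_lintegral_of_indepFun _ V hind hVm
    _ = ∏ i, expNeg (μ (B i) * (1 - expNeg (C i))) := Finset.prod_congr rfl fun i _ =>
        lintegral_expNeg_count hinj hP (hBm i) (hg _ (hC0 i)) _
    _ = expNeg (∫⁻ x, (1 - expNeg (g x)) ∂μ) := by
        rw [← expNeg_sum]
        congr 1
        simp_rw [hsum (fun y => 1 - expNeg y) (by simp)]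
        rw [lintegral_finsetSum _ fun i _ => (measurable_one.indicator (hBm i)).const_mul _]
        refine Finset.sum_congr rfl fun i _ => ?_
        rw [lintegral_const_mul _ (measurable_one.indicator (hBm i)),
          lintegral_indicator_one (hBm i), mul_comm]

/-- The Laplace functional of a Poisson process. -/
theorem lintegral_expNeg_tsum_poisson [IsProbabilityMeasure P] [SigmaFinite μ] (hu : ∀ n, Measurable (u n))
    (hinj : ∀ᵐ ω ∂P, Function.Injective (fun n => u n ω))
    (hP : IsPoissonProcess μ (fun ω => Set.range (fun n => u n ω)) P) {f : S → ℝ≥0∞}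
    (hf : Measurable f) :
    ∫⁻ ω, expNeg (∑' n, f (u n ω)) ∂P = expNeg (∫⁻ x, (1 - expNeg (f x)) ∂μ) := by
  -- Cutting off to spanning sets makes every nonzero level set of finite measure, while `g k` still
  -- increases to `f`.
  let g : ℕ → SimpleFunc S ℝ≥0∞ := fun k => (SimpleFunc.eapprox f k).restrict (spanningSets μ k)
  have hgv : ∀ k x, g k x = (spanningSets μ k).indicator (SimpleFunc.eapprox f k) x := fun k x =>
    SimpleFunc.restrict_apply _ (measurableSet_spanningSets μ k) x
  have hmono : ∀ x, Monotone fun k => g k x := fun x k l hkl => by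
    simp only [hgv]
    exact (Set.indicator_le_indicator_of_subset (monotone_spanningSets μ hkl)
      (fun _ => zero_le) x).trans
      (Set.indicator_le_indicator (SimpleFunc.monotone_eapprox f hkl x))
  have hsup : ∀ x, ⨆ k, g k x = f x := fun x => by
    refine le_antisymm (iSup_le fun k => ?_) ?_
    · rw [hgv, ← SimpleFunc.iSup_eapprox_apply hf x]
      exact (Set.indicator_le_self' (fun _ _ => zero_le) x).trans
        (le_iSup (fun k => SimpleFunc.eapprox f k x) k)
    · rw [← SimpleFunc.iSup_eapprox_apply hf x]
      refine iSup_le fun k => ?_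
      have hx : x ∈ spanningSets μ (max k (spanningSetsIndex μ x)) :=
        monotone_spanningSets μ (le_max_right _ _) (mem_spanningSetsIndex μ x)
      refine le_iSup_of_le (max k (spanningSetsIndex μ x)) ?_
      rw [hgv, Set.indicator_of_mem hx]
      exact SimpleFunc.monotone_eapprox f (le_max_left _ _) x
  have hstep : ∀ k, ∫⁻ ω, expNeg (∑' n, g k (u n ω)) ∂P
      = expNeg (∫⁻ x, (1 - expNeg (g k x)) ∂μ) := fun k => by
    refine lintegral_expNeg_sum_simpleFunc hu hinj hP (g k) fun c hc => ?_
    refine ne_top_of_le_ne_top (measure_spanningSets_lt_top μ k).ne (measure_mono fun x hx => ?_)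
    by_contra h
    have hx : g k x = c := hx
    rw [hgv, Set.indicator_of_notMem h] at hx
    exact hc hx.symm
  have hlim : ∀ x, Filter.Tendsto (fun k => g k x) Filter.atTop (nhds (f x)) := fun x =>
    hsup x ▸ tendsto_atTop_iSup (hmono x)
  have hl : Filter.Tendsto (fun k => ∫⁻ ω, expNeg (∑' n, g k (u n ω)) ∂P) Filter.atTop
      (nhds (∫⁻ ω, expNeg (∑' n, f (u n ω)) ∂P)) := by
    refine tendsto_lintegral_of_dominated_convergence (fun _ => 1) (fun k => ?_)
      (fun k => ae_of_all _ fun ω => expNeg_le_one _) (by simp) (ae_of_all _ fun ω => ?_)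
    · exact measurable_expNeg.comp (Measurable.tsum fun n => (g k).measurable.comp (hu n))
    · refine (continuous_expNeg.tendsto _).comp ?_
      simp_rw [← lintegral_count]
      exact lintegral_tendsto_of_tendsto_of_monotone (fun k => (measurable_of_countable _).aemeasurable)
        (ae_of_all _ fun n => hmono _) (ae_of_all _ fun n => hlim _)
  have hr : Filter.Tendsto (fun k => expNeg (∫⁻ x, (1 - expNeg (g k x)) ∂μ)) Filter.atTop
      (nhds (expNeg (∫⁻ x, (1 - expNeg (f x)) ∂μ))) := by
    refine (continuous_expNeg.tendsto _).comp ?_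
    refine lintegral_tendsto_of_tendsto_of_monotone (fun k => ?_) (ae_of_all _ fun x => ?_)
      (ae_of_all _ fun x => ?_)
    · exact (measurable_const.sub (measurable_expNeg.comp (g k).measurable)).aemeasurable
    · exact fun k l hkl => tsub_le_tsub_left (expNeg_antitone (hmono x hkl)) _
    · exact ENNReal.Tendsto.sub tendsto_const_nhds
        ((continuous_expNeg.tendsto _).comp (hlim x)) (Or.inl ENNReal.one_ne_top)
  simp_rw [hstep] at hl
  exact tendsto_nhds_unique hl hr

end Poisson

instance sigmaFinite_stableIntensity (a : ℝ) : SigmaFinite (stableIntensity a) := by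
  unfold stableIntensity
  exact SigmaFinite.withDensity_ofReal _

/-! ### Independence and Laplace transforms. -/

section Independence

variable {Ω : Type*} [mΩ : MeasurableSpace Ω] {P : Measure Ω}

theorem lintegral_expNeg_tsum_of_iIndepFun [IsProbabilityMeasure P] {ι : Type*} [Countable ι] {V : ι → Ω → ℝ≥0∞}
    (hV : ∀ i, Measurable (V i)) (hind : iIndepFun V P) {v : ι → ℝ≥0∞}
    (h : ∀ i, ∫⁻ ω, expNeg (V i ω) ∂P = expNeg (v i)) :
    ∫⁻ ω, expNeg (∑' i, V i ω) ∂P = expNeg (∑' i, v i) := by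
  have hfin : ∀ s : Finset ι, ∫⁻ ω, expNeg (∑ i ∈ s, V i ω) ∂P = expNeg (∑ i ∈ s, v i) :=
    fun s => by
      simp_rw [expNeg_sum, ← h]
      exact lintegral_prod_eq_prod_lintegral_of_indepFun s _
        (hind.comp (fun _ => expNeg) fun _ => measurable_expNeg)
        fun i => measurable_expNeg.comp (hV i)
  have hl : Filter.Tendsto (fun s : Finset ι => ∫⁻ ω, expNeg (∑ i ∈ s, V i ω) ∂P) Filter.atTop
      (nhds (∫⁻ ω, expNeg (∑' i, V i ω) ∂P)) :=
    tendsto_lintegral_filter_of_dominated_convergence (fun _ => 1)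
      (Filter.Eventually.of_forall fun s => by fun_prop)
      (Filter.Eventually.of_forall fun s => ae_of_all _ fun ω => expNeg_le_one _) (by simp)
      (ae_of_all _ fun ω => tendsto_expNeg_sum _)
  simp_rw [hfin] at hl
  exact tendsto_nhds_unique hl (tendsto_expNeg_sum v)

/-- Lets one variable be frozen while the other is integrated out, without conditional expectations.
-/
theorem lintegral_comp_of_indepFun [IsProbabilityMeasure P] {E F : Type*} [MeasurableSpace E] [MeasurableSpace F]
    {X : Ω → E} {Y : Ω → F} (hX : Measurable X) (hY : Measurable Y) (hXY : IndepFun X Y P)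
    {f : E × F → ℝ≥0∞} (hf : Measurable f) :
    ∫⁻ ω, f (X ω, Y ω) ∂P = ∫⁻ ω, ∫⁻ ω', f (X ω, Y ω') ∂P ∂P := by
  have h := (indepFun_iff_map_prod_eq_prod_map_map hX.aemeasurable hY.aemeasurable).1 hXY
  rw [← lintegral_map (f := f) hf (hX.prodMk hY), h, lintegral_prod _ hf.aemeasurable,
    lintegral_map (by fun_prop) hX]
  refine lintegral_congr fun ω => ?_
  rw [lintegral_map (by fun_prop) hY]

/-- The rectangles `X i ⁻¹' s ∩ Y i ⁻¹' t` form a π-system generating the σ-algebra of the pair, and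
on them the probability factorizes. -/
theorem iIndepFun_prodMk [IsProbabilityMeasure P] {ι E F : Type*} [MeasurableSpace E] [MeasurableSpace F]
    {X : ι → Ω → E} {Y : ι → Ω → F} (hX : ∀ i, Measurable (X i)) (hY : ∀ i, Measurable (Y i))
    (hiX : iIndepFun X P) (hiY : iIndepFun Y P)
    (hXY : IndepFun (fun ω i => X i ω) (fun ω i => Y i ω) P) :
    iIndepFun (fun i ω => (X i ω, Y i ω)) P := by
  let π : ι → Set (Set Ω) := fun i =>
    {A | ∃ s t, MeasurableSet s ∧ MeasurableSet t ∧ A = X i ⁻¹' s ∩ Y i ⁻¹' t}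
  have hmul : ∀ (S : Finset ι) (s : ι → Set E) (t : ι → Set F), (∀ i, MeasurableSet (s i)) →
      (∀ i, MeasurableSet (t i)) → P (⋂ i ∈ S, (X i ⁻¹' s i ∩ Y i ⁻¹' t i))
        = (∏ i ∈ S, P (X i ⁻¹' s i)) * ∏ i ∈ S, P (Y i ⁻¹' t i) := fun S s t hs ht => by
    rw [← hiX.measure_inter_preimage_eq_mul S (fun i _ => hs i),
      ← hiY.measure_inter_preimage_eq_mul S (fun i _ => ht i)]
    have h := hXY.measure_inter_preimage_eq_mul (⋂ i ∈ S, (fun x : ι → E => x i) ⁻¹' s i)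
      (⋂ i ∈ S, (fun y : ι → F => y i) ⁻¹' t i)
      (S.measurableSet_biInter fun i _ => measurable_pi_apply i (hs i))
      (S.measurableSet_biInter fun i _ => measurable_pi_apply i (ht i))
    simp only [Set.preimage_iInter] at h
    refine Eq.trans ?_ h
    congr 1
    ext ω
    simp only [Set.mem_iInter, Set.mem_inter_iff, Set.mem_preimage]
    exact ⟨fun h => ⟨fun i hi => (h i hi).1, fun i hi => (h i hi).2⟩,
      fun h i hi => ⟨h.1 i hi, h.2 i hi⟩⟩
  have hsets : iIndepSets π P := by
    rw [iIndepSets_iff]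
    intro S f hf
    classical
    have hf' : ∀ i, ∃ s t, MeasurableSet s ∧ MeasurableSet t ∧
        (i ∈ S → f i = X i ⁻¹' s ∩ Y i ⁻¹' t) := fun i => by
      by_cases hi : i ∈ S
      · obtain ⟨s, t, hs, ht, h⟩ := hf i hi
        exact ⟨s, t, hs, ht, fun _ => h⟩
      · exact ⟨∅, ∅, .empty, .empty, fun h => absurd h hi⟩
    choose s t hs ht hst using hf'
    have h1 : ∀ i ∈ S, P (f i) = P (X i ⁻¹' s i) * P (Y i ⁻¹' t i) := fun i hi => by
      rw [hst i hi]
      simpa using hmul {i} s t hs ht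
    rw [Finset.prod_congr rfl h1, Finset.prod_mul_distrib, ← hmul S s t hs ht]
    congr 1
    exact Set.iInter₂_congr hst
  refine iIndepSets.iIndep (fun i => ((hX i).prodMk (hY i)).comap_le) π ?_ ?_ hsets
  · rintro i _ ⟨s, t, hs, ht, rfl⟩ _ ⟨s', t', hs', ht', rfl⟩ -
    exact ⟨s ∩ s', t ∩ t', hs.inter hs', ht.inter ht', by
      rw [Set.preimage_inter, Set.preimage_inter, Set.inter_inter_inter_comm]⟩
  · intro i
    rw [← generateFrom_prod, MeasurableSpace.comap_generateFrom]
    congr 1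
    ext A
    constructor
    · rintro ⟨_, ⟨s, hs, t, ht, rfl⟩, rfl⟩
      exact ⟨s, t, hs, ht, rfl⟩
    · rintro ⟨s, t, hs, ht, rfl⟩
      exact ⟨s ×ˢ t, ⟨s, hs, t, ht, rfl⟩, rfl⟩

theorem iIndepFun_curry [IsProbabilityMeasure P] {ι κ E : Type*} [MeasurableSpace E] {X : ι × κ → Ω → E}
    (hX : ∀ i, Measurable (X i)) (h : iIndepFun X P) :
    iIndepFun (fun i ω (j : κ) => X (i, j) ω) P := by
  rw [iIndepFun_iff_map_fun_eq_infinitePi_map (by fun_prop)]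
  have h1 : ∀ i, P.map (fun ω (j : κ) => X (i, j) ω)
      = Measure.infinitePi fun j => P.map (X (i, j)) := fun i =>
    (iIndepFun.precomp (g := fun j : κ => (i, j)) (fun _ _ h => (Prod.mk.inj h).2) h
      ).map_fun_eq_infinitePi_map fun j => hX _
  simp_rw [h1]
  have := fun i => Measure.isProbabilityMeasure_map (μ := P) (hX i).aemeasurable
  rw [← Measure.infinitePi_map_curry, ← h.map_fun_eq_infinitePi_map hX,
    Measure.map_map (by fun_prop) (by fun_prop)]
  rfl

theorem indepFun_of_measurable_iSup {ι E F G : Type*} [MeasurableSpace E] [MeasurableSpace F]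
    [MeasurableSpace G] {ξ : ι → Ω → E} (hξ : ∀ i, Measurable (ξ i)) (h : iIndepFun ξ P)
    {S T : Set ι} (hST : Disjoint S T) {X : Ω → F} {Y : Ω → G}
    (hX : Measurable[⨆ i ∈ S, MeasurableSpace.comap (ξ i) inferInstance] X)
    (hY : Measurable[⨆ i ∈ T, MeasurableSpace.comap (ξ i) inferInstance] Y) : IndepFun X Y P := by
  rw [IndepFun_iff_Indep]
  have := indep_iSup_of_disjoint (fun i => (hξ i).comap_le) h.iIndep hST
  exact indep_of_indep_of_le_right (indep_of_indep_of_le_left this hX.comap_le) hY.comap_le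

end Independence

/-! ### One vertex: a marked stable Poisson process. -/

/-- With the points frozen, averaging over the marks leaves a functional of the points alone, to
which the Poisson formula applies. Fubini then brings the mark integral outside, and scaling
evaluates the integral over the points for each fixed mark. -/
theorem lintegral_expNeg_marked_stable {Ω : Type*} [MeasurableSpace Ω] {P : Measure Ω}
    [IsProbabilityMeasure P] {a s : ℝ} (ha : 0 < a) (hs : 0 < s) {u : ℕ → Ω → ℝ}
    {U : ℕ → Ω → unitInterval} (hu : ∀ n, Measurable (u n))
    (hanti : ∀ᵐ ω ∂P, StrictAnti (fun n => u n ω))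
    (hP : IsPoissonProcess (stableIntensity a) (fun ω => Set.range (fun n => u n ω)) P)
    (hU : ∀ n, Measurable (U n)) (hlaw : ∀ n, HasLaw (U n) volume P) (hind : iIndepFun U P)
    (huU : IndepFun (fun ω n => u n ω) (fun ω n => U n ω) P) {k : unitInterval → ℝ≥0∞}
    (hk : Measurable k) (θ : ℝ≥0∞) :
    ∫⁻ ω, expNeg (∑' n, k (U n ω) * (θ * ENNReal.ofReal (u n ω)) ^ s) ∂P
      = expNeg (stableConst a s * (∫⁻ y, k y ^ (a / s)) * θ ^ a) := by
  let F : (ℕ → ℝ) × (ℕ → unitInterval) → ℝ≥0∞ := fun p =>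
    expNeg (∑' n, k (p.2 n) * (θ * ENNReal.ofReal (p.1 n)) ^ s)
  have hF : Measurable F := by fun_prop
  -- Chosen so that `expNeg (f x)` is the mark average at a point `x`; the product of these averages
  -- is then again `expNeg` of a sum over the points.
  let f : ℝ → ℝ≥0∞ := fun x => negLog (∫⁻ y, expNeg (k y * (θ * ENNReal.ofReal x) ^ s))
  have hf1 : ∀ x : ℝ, ∫⁻ y, expNeg (k y * (θ * ENNReal.ofReal x) ^ s) ≤ 1 := fun x =>
    (lintegral_mono fun y => expNeg_le_one _).trans (by simp)
  have hfe : ∀ x, expNeg (f x) = ∫⁻ y, expNeg (k y * (θ * ENNReal.ofReal x) ^ s) := fun x =>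
    expNeg_negLog (hf1 x)
  have hfm : Measurable f := measurable_negLog.comp (Measurable.lintegral_prod_right' (f :=
    fun p : ℝ × unitInterval => expNeg (k p.2 * (θ * ENNReal.ofReal p.1) ^ s)) (by fun_prop))
  calc ∫⁻ ω, expNeg (∑' n, k (U n ω) * (θ * ENNReal.ofReal (u n ω)) ^ s) ∂P
      = ∫⁻ ω, F (fun n => u n ω, fun n => U n ω) ∂P := rfl
    _ = ∫⁻ ω, ∫⁻ ω', F (fun n => u n ω, fun n => U n ω') ∂P ∂P :=
        lintegral_comp_of_indepFun (by fun_prop) (by fun_prop) huU hF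
    _ = ∫⁻ ω, expNeg (∑' n, f (u n ω)) ∂P := by
        refine lintegral_congr fun ω => ?_
        refine lintegral_expNeg_tsum_of_iIndepFun
          (V := fun n ω' => k (U n ω') * (θ * ENNReal.ofReal (u n ω)) ^ s) (by fun_prop)
          (hind.comp (fun n y => k y * (θ * ENNReal.ofReal (u n ω)) ^ s) (by fun_prop))
          fun n => ?_
        rw [hfe, ← (hlaw n).map_eq, lintegral_map (by fun_prop) (hU n)]
    _ = expNeg (∫⁻ x, (1 - expNeg (f x)) ∂stableIntensity a) :=
        lintegral_expNeg_tsum_poisson hu (hanti.mono fun ω h => h.injective) hP hfm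
    _ = expNeg (∫⁻ x, ∫⁻ y, (1 - expNeg (k y * (θ * ENNReal.ofReal x) ^ s)) ∂volume
          ∂stableIntensity a) := by
        congr 1
        refine lintegral_congr fun x => ?_
        rw [hfe, lintegral_sub (by fun_prop) ((hf1 x).trans_lt ENNReal.one_lt_top).ne
          (ae_of_all _ fun y => expNeg_le_one _)]
        simp
    _ = expNeg (∫⁻ y, ((k y * θ ^ s) ^ (a / s) * stableConst a s)) := by
        congr 1
        rw [lintegral_lintegral_swap (by fun_prop)]
        refine lintegral_congr fun y => ?_
        rw [← lintegral_one_sub_expNeg_mul_rpow ha hs]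
        simp_rw [ENNReal.mul_rpow_of_nonneg _ _ hs.le, mul_assoc]
    _ = _ := by
        congr 1
        have h : ∀ y, (k y * θ ^ s) ^ (a / s) * stableConst a s
            = k y ^ (a / s) * (θ ^ a * stableConst a s) := fun y => by
          rw [ENNReal.mul_rpow_of_nonneg _ _ (by positivity), ← ENNReal.rpow_mul,
            mul_div_cancel₀ _ hs.ne', mul_assoc]
        simp_rw [h]
        rw [lintegral_mul_const _ (by fun_prop)]
        ring

/-! ### Recursion over the levels of the tree. -/

section Tree

variable {Ω : Type*} {r : ℕ}

/-- The `i`-th vertex on the path from the root to the vertex `a ∈ ℕ^l`. -/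
def pathVertex {l : ℕ} (hl : l ≤ r) (a : Fin l → ℕ) (i : Fin l) : InnerVertex r :=
  ⟨Fin.castLE hl i, fun j => a (Fin.castLE i.isLt.le j)⟩

/-- The product of the points `u` over the path from the root to the vertex `a ∈ ℕ^l`. -/
noncomputable def vertexProd (u : InnerVertex r → ℕ → Ω → ℝ) {l : ℕ} (hl : l ≤ r) (a : Fin l → ℕ)
    (ω : Ω) : ℝ≥0∞ :=
  ∏ i, ENNReal.ofReal (u (pathVertex hl a i) (a i) ω)

/-- The marks along the path from the root to the vertex `a ∈ ℕ^l`. -/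
def vertexMarks (U : InnerVertex r → ℕ → Ω → unitInterval) {l : ℕ} (hl : l ≤ r) (a : Fin l → ℕ)
    (ω : Ω) : Fin l → unitInterval :=
  fun i => U (pathVertex hl a i) (a i) ω

theorem pathVertex_snoc_castSucc {l : ℕ} (hl : l + 1 ≤ r) (a : Fin l → ℕ) (n : ℕ) (i : Fin l) :
    pathVertex hl (Fin.snoc a n) i.castSucc = pathVertex (Nat.le_of_succ_le hl) a i := by
  unfold pathVertex
  refine Sigma.ext rfl (heq_of_eq (funext fun j => ?_))
  exact Fin.snoc_castSucc (α := fun _ => ℕ) n a (Fin.castLE i.isLt.le j)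

theorem pathVertex_snoc_last {l : ℕ} (hl : l + 1 ≤ r) (a : Fin l → ℕ) (n : ℕ) :
    pathVertex hl (Fin.snoc a n) (Fin.last l) = ⟨⟨l, hl⟩, a⟩ := by
  unfold pathVertex
  refine Sigma.ext rfl (heq_of_eq (funext fun j => ?_))
  exact Fin.snoc_castSucc (α := fun _ => ℕ) n a j

theorem vertexProd_snoc (u : InnerVertex r → ℕ → Ω → ℝ) {l : ℕ} (hl : l + 1 ≤ r) (a : Fin l → ℕ)
    (n : ℕ) (ω : Ω) :
    vertexProd u hl (Fin.snoc a n) ω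
      = vertexProd u (Nat.le_of_succ_le hl) a ω * ENNReal.ofReal (u ⟨⟨l, hl⟩, a⟩ n ω) := by
  simp only [vertexProd, Fin.prod_univ_castSucc, pathVertex_snoc_castSucc, pathVertex_snoc_last,
    Fin.snoc_castSucc, Fin.snoc_last]

theorem vertexMarks_snoc (U : InnerVertex r → ℕ → Ω → unitInterval) {l : ℕ} (hl : l + 1 ≤ r)
    (a : Fin l → ℕ) (n : ℕ) (ω : Ω) :
    vertexMarks U hl (Fin.snoc a n) ω
      = Fin.snoc (vertexMarks U (Nat.le_of_succ_le hl) a ω) (U ⟨⟨l, hl⟩, a⟩ n ω) := by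
  funext i
  refine Fin.lastCases ?_ (fun j => ?_) i
  · rw [vertexMarks, Fin.snoc_last, pathVertex_snoc_last]
    simp
  · rw [vertexMarks, Fin.snoc_castSucc, pathVertex_snoc_castSucc]
    simp [vertexMarks]

theorem measurable_snoc {E : Type*} [MeasurableSpace E] (l : ℕ) :
    Measurable fun p : (Fin l → E) × E => (Fin.snoc p.1 p.2 : Fin (l + 1) → E) := by
  refine measurable_pi_iff.2 fun i => ?_
  refine Fin.lastCases ?_ (fun j => ?_) i
  · simpa using measurable_snd
  · simp only [Fin.snoc_castSucc]
    fun_prop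

theorem lintegral_snoc {E : Type*} [MeasureSpace E] [SigmaFinite (volume : Measure E)] {l : ℕ}
    {f : (Fin (l + 1) → E) → ℝ≥0∞} (hf : Measurable f) :
    ∫⁻ x, f x = ∫⁻ x : Fin l → E, ∫⁻ y : E, f (Fin.snoc x y) := by
  have h := (volume_preserving_piFinSuccAbove (fun _ : Fin (l + 1) => E) (Fin.last l)).symm
  rw [← h.lintegral_comp hf, Measure.volume_eq_prod, lintegral_prod_symm]
  · refine lintegral_congr fun x => lintegral_congr fun y => ?_
    simp [MeasurableEquiv.piFinSuccAbove_symm_apply, Fin.insertNthEquiv, Fin.insertNth_last']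
  · exact (hf.comp h.measurable).aemeasurable

theorem tsum_snoc {l : ℕ} (f : (Fin (l + 1) → ℕ) → ℝ≥0∞) :
    ∑' b, f b = ∑' a : Fin l → ℕ, ∑' n : ℕ, f (Fin.snoc a n) := by
  rw [← (Fin.snocEquiv fun _ => ℕ).tsum_eq, ENNReal.tsum_prod', ENNReal.tsum_comm]
  rfl

variable [MeasurableSpace Ω] {P : Measure Ω} [IsProbabilityMeasure P] {ζ : Fin r → ℝ}
  {u : InnerVertex r → ℕ → Ω → ℝ} {U : InnerVertex r → ℕ → Ω → unitInterval}

/-- Integrating out the points and the marks of the children of the vertices in `ℕ^l`. -/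
theorem lintegral_expNeg_level (hu : IsCascadePoints ζ u P) (hUm : ∀ a n, Measurable (U a n))
    (hlaw : ∀ a n, HasLaw (U a n) volume P)
    (hU : iIndepFun (fun (v : InnerVertex r × ℕ) (ω : Ω) => U v.1 v.2 ω) P)
    (huU : IndepFun (fun (ω : Ω) (v : InnerVertex r × ℕ) => u v.1 v.2 ω)
      (fun (ω : Ω) (v : InnerVertex r × ℕ) => U v.1 v.2 ω) P)
    {l : ℕ} (hl : l + 1 ≤ r) (hζ : 0 < ζ ⟨l, hl⟩) {s : ℝ} (hs : 0 < s)
    {K : (Fin (l + 1) → unitInterval) → ℝ≥0∞} (hK : Measurable K) (t : ℝ≥0∞) :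
    ∫⁻ ω, expNeg (∑' b, K (vertexMarks U hl b ω) * (t * vertexProd u hl b ω) ^ s) ∂P
      = ∫⁻ ω, expNeg (∑' a, stableConst (ζ ⟨l, hl⟩) s *
          (∫⁻ y, K (Fin.snoc (vertexMarks U (Nat.le_of_succ_le hl) a ω) y) ^ (ζ ⟨l, hl⟩ / s)) *
          (t * vertexProd u (Nat.le_of_succ_le hl) a ω) ^ ζ ⟨l, hl⟩) ∂P := by
  have hl' := Nat.le_of_succ_le hl
  have hum := hu.measurable
  have hUi : iIndepFun (fun a ω (n : ℕ) => U a n ω) P := iIndepFun_curry (fun v => hUm v.1 v.2) hU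
  have huUi : IndepFun (fun ω a (n : ℕ) => u a n ω) (fun ω a (n : ℕ) => U a n ω) P :=
    huU.comp (φ := fun (f : InnerVertex r × ℕ → ℝ) (a : InnerVertex r) (n : ℕ) => f (a, n))
      (ψ := fun (f : InnerVertex r × ℕ → unitInterval) (a : InnerVertex r) (n : ℕ) => f (a, n))
      (by fun_prop) (by fun_prop)
  -- All randomness attached to the children of a vertex, bundled so that the family is independent
  -- over vertices. The path to a vertex of level `l` uses only `ξ` at levels below `l` (the set
  -- `S`), and its children only `ξ` at level `l` (the set `T`).
  let ξ : InnerVertex r → Ω → (ℕ → ℝ) × (ℕ → unitInterval) :=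
    fun a ω => (fun n => u a n ω, fun n => U a n ω)
  have hξm : ∀ a, Measurable (ξ a) := fun a => by fun_prop
  have hξ : iIndepFun ξ P := iIndepFun_prodMk (by fun_prop) (by fun_prop) hu.iIndepFun hUi huUi
  let S : Set (InnerVertex r) := {v | (v.1 : ℕ) < l}
  let T : Set (InnerVertex r) := {v | (v.1 : ℕ) = l}
  have hST : Disjoint S T := Set.disjoint_left.2 fun v h1 h2 => by
    simp only [S, T, Set.mem_ofPred_eq] at h1 h2
    omega
  have hmem : ∀ (A : Set (InnerVertex r)) v, v ∈ A →
      Measurable[⨆ i ∈ A, MeasurableSpace.comap (ξ i) inferInstance] (ξ v) := fun A v hv =>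
    (comap_measurable (ξ v)).mono
      (le_iSup₂_of_le (f := fun i (_ : i ∈ A) => MeasurableSpace.comap (ξ i) inferInstance)
        v hv le_rfl) le_rfl
  let X : Ω → (Fin l → ℕ) → ℝ≥0∞ × (Fin l → unitInterval) :=
    fun ω a => (vertexProd u hl' a ω, vertexMarks U hl' a ω)
  let Y : Ω → (Fin l → ℕ) → (ℕ → ℝ) × (ℕ → unitInterval) := fun ω a => ξ ⟨⟨l, hl⟩, a⟩ ω
  have hXS : Measurable[⨆ i ∈ S, MeasurableSpace.comap (ξ i) inferInstance] X := by
    have hv : ∀ a i, pathVertex hl' a i ∈ S := fun a i => i.isLt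
    refine @measurable_pi_lambda _ _ _ (_) _ _ fun a => ?_
    refine @Measurable.prodMk _ _ _ (_) (_) (_) _ _ ?_ ?_
    · unfold vertexProd
      refine @Finset.measurable_fun_prod _ _ _ _ _ _ (_) _ _ fun i _ => ?_
      exact ENNReal.measurable_ofReal.comp
        (((measurable_pi_apply (a i)).comp measurable_fst).comp (hmem S _ (hv a i)))
    · refine @measurable_pi_lambda _ _ _ (_) _ _ fun i => ?_
      exact ((measurable_pi_apply (a i)).comp measurable_snd).comp (hmem S _ (hv a i))
  have hYT : Measurable[⨆ i ∈ T, MeasurableSpace.comap (ξ i) inferInstance] Y :=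
    @measurable_pi_lambda _ _ _ (_) _ _ fun a => hmem T _ rfl
  have hle : ∀ A : Set (InnerVertex r),
      (⨆ i ∈ A, MeasurableSpace.comap (ξ i) inferInstance) ≤ ‹MeasurableSpace Ω› := fun A =>
    iSup₂_le fun i _ => (hξm i).comap_le
  have hXY : IndepFun X Y P := indepFun_of_measurable_iSup hξm hξ hST hXS hYT
  have hXm : Measurable X := hXS.mono (hle S) le_rfl
  have hYm : Measurable Y := hYT.mono (hle T) le_rfl
  let G : ℝ≥0∞ × (Fin l → unitInterval) → (ℕ → ℝ) × (ℕ → unitInterval) → ℝ≥0∞ :=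
    fun p q => ∑' n, K (Fin.snoc p.2 (q.2 n)) * (t * p.1 * ENNReal.ofReal (q.1 n)) ^ s
  have hKs : ∀ n : ℕ, Measurable fun pq : (ℝ≥0∞ × (Fin l → unitInterval)) ×
      ((ℕ → ℝ) × (ℕ → unitInterval)) => K (Fin.snoc pq.1.2 (pq.2.2 n)) := fun n => by
    have h : Measurable fun pq : (ℝ≥0∞ × (Fin l → unitInterval)) ×
      ((ℕ → ℝ) × (ℕ → unitInterval)) => (pq.1.2, pq.2.2 n) := by fun_prop
    exact hK.comp ((measurable_snoc l).comp h)
  have hG : Measurable (fun pq : (ℝ≥0∞ × (Fin l → unitInterval)) ×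
      ((ℕ → ℝ) × (ℕ → unitInterval)) => G pq.1 pq.2) :=
    Measurable.tsum fun n => (hKs n).mul (by fun_prop)
  let F : ((Fin l → ℕ) → ℝ≥0∞ × (Fin l → unitInterval)) ×
      ((Fin l → ℕ) → (ℕ → ℝ) × (ℕ → unitInterval)) → ℝ≥0∞ := fun pq =>
    expNeg (∑' a, G (pq.1 a) (pq.2 a))
  have hpq : ∀ a, Measurable fun pq : ((Fin l → ℕ) → ℝ≥0∞ × (Fin l → unitInterval)) ×
      ((Fin l → ℕ) → (ℕ → ℝ) × (ℕ → unitInterval)) => (pq.1 a, pq.2 a) := by fun_prop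
  have hF : Measurable F :=
    measurable_expNeg.comp (Measurable.tsum fun a => hG.comp (hpq a))
  calc ∫⁻ ω, expNeg (∑' b, K (vertexMarks U hl b ω) * (t * vertexProd u hl b ω) ^ s) ∂P
      = ∫⁻ ω, F (X ω, Y ω) ∂P := by
        refine lintegral_congr fun ω => ?_
        rw [tsum_snoc]
        simp_rw [vertexProd_snoc, vertexMarks_snoc, ← mul_assoc]
        rfl
    _ = ∫⁻ ω, ∫⁻ ω', F (X ω, Y ω') ∂P ∂P := lintegral_comp_of_indepFun hXm hYm hXY hF
    _ = _ := by
        refine lintegral_congr fun ω => ?_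
        refine lintegral_expNeg_tsum_of_iIndepFun
          (V := fun a ω' => G (X ω a) (ξ ⟨⟨l, hl⟩, a⟩ ω')) (fun a => ?_) ?_ fun a => ?_
        · exact hG.comp (f := fun ω' => (X ω a, ξ ⟨⟨l, hl⟩, a⟩ ω')) (by fun_prop)
        · have h := iIndepFun.precomp (g := fun a : Fin l → ℕ => (⟨⟨l, hl⟩, a⟩ : InnerVertex r))
            (sigma_mk_injective (β := fun i : Fin r => Fin i → ℕ) (i := ⟨l, hl⟩)) hξ
          exact h.comp (fun a q => G (X ω a) q) fun a =>
            hG.comp (f := fun q => (X ω a, q)) (by fun_prop)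
        · let v : InnerVertex r := ⟨⟨l, hl⟩, a⟩
          have hUv : iIndepFun (fun n ω => U v n ω) P :=
            iIndepFun.precomp (g := fun n : ℕ => (v, n)) (fun m n h => (Prod.mk.inj h).2) hU
          have huUv : IndepFun (fun ω n => u v n ω) (fun ω n => U v n ω) P :=
            huUi.comp (measurable_pi_apply v) (measurable_pi_apply v)
          have hk : Measurable fun y => K (Fin.snoc (X ω a).2 y) :=
            hK.comp ((measurable_snoc l).comp measurable_prodMk_left)
          exact lintegral_expNeg_marked_stable hζ hs (hum v) (hu.strictAnti v)
            (hu.isPoissonProcess v) (hUm v) (hlaw v) hUv huUv hk (t * (X ω a).1)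

/-- The sum of the products `w_α` weighted by `f (Ω_α)` is a one-sided stable variable. -/
theorem exists_laplace_cascade (hr : 1 ≤ r) (hmono : StrictMono ζ) (h0 : 0 < ζ ⟨0, hr⟩)
    (h1 : ζ ⟨r - 1, Nat.sub_lt hr Nat.one_pos⟩ < 1) (hu : IsCascadePoints ζ u P)
    (hUm : ∀ a n, Measurable (U a n)) (hlaw : ∀ a n, HasLaw (U a n) volume P)
    (hU : iIndepFun (fun (v : InnerVertex r × ℕ) (ω : Ω) => U v.1 v.2 ω) P)
    (huU : IndepFun (fun (ω : Ω) (v : InnerVertex r × ℕ) => u v.1 v.2 ω)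
      (fun (ω : Ω) (v : InnerVertex r × ℕ) => U v.1 v.2 ω) P)
    {f : (Fin r → unitInterval) → ℝ≥0∞} (hf : Measurable f) (hf0 : ∀ x, f x ≠ 0)
    (hfi : ∫⁻ x, f x ^ ζ ⟨r - 1, Nat.sub_lt hr Nat.one_pos⟩ ≠ ∞) :
    ∃ c : ℝ≥0∞, c ≠ 0 ∧ c ≠ ∞ ∧ ∀ t : ℝ≥0∞,
      ∫⁻ ω, expNeg (t * ∑' α, f (vertexMarks U le_rfl α ω) * vertexProd u le_rfl α ω) ∂P
        = expNeg (c * t ^ ζ ⟨0, hr⟩) := by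
  -- The value `1` at `l = r` makes the original sum, which is linear in the products, the starting
  -- case of the recursion.
  let s : ℕ → ℝ := fun l => if h : l < r then ζ ⟨l, h⟩ else 1
  have hsl : ∀ l (h : l < r), s l = ζ ⟨l, h⟩ := fun l h => dif_pos h
  have hspos : ∀ l, 0 < s l := fun l => by
    by_cases h : l < r
    · rw [hsl l h]
      exact h0.trans_le (hmono.monotone (Fin.mk_le_mk.2 (Nat.zero_le l)))
    · simp [s, h]
  have hsr : s r = 1 := by simp [s]
  have hslt : ∀ l, l < r → s l < s (l + 1) := fun l h => by
    rw [hsl l h]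
    by_cases h' : l + 1 < r
    · rw [hsl _ h']
      exact hmono (Fin.mk_lt_mk.2 (Nat.lt_succ_self l))
    · have : l = r - 1 := by omega
      subst this
      simpa [s, h'] using h1
  -- The exponent `s (l - 1) / s l` is the one in the mark integral of the next step towards the
  -- root. At `l = 0` truncated subtraction makes it `1`, and the condition says that the final
  -- constant is finite.
  have key : ∀ l (hl : l ≤ r), ∃ K : (Fin l → unitInterval) → ℝ≥0∞, Measurable K ∧
      (∀ x, K x ≠ 0) ∧ ∫⁻ x, K x ^ (s (l - 1) / s l) ≠ ∞ ∧ ∀ t : ℝ≥0∞,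
      ∫⁻ ω, expNeg (t * ∑' α, f (vertexMarks U le_rfl α ω) * vertexProd u le_rfl α ω) ∂P
        = ∫⁻ ω, expNeg (∑' a, K (vertexMarks U hl a ω) * (t * vertexProd u hl a ω) ^ s l) ∂P := by
    intro l hl
    induction hl using Nat.decreasingInduction with
    | self =>
      refine ⟨f, hf, hf0, ?_, fun t => ?_⟩
      · rwa [hsr, div_one, hsl (r - 1) (Nat.sub_lt hr Nat.one_pos)]
      · refine lintegral_congr fun ω => ?_
        rw [← ENNReal.tsum_mul_left, hsr]
        simp_rw [ENNReal.rpow_one]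
        congr 2
        funext α
        ring
    | of_succ l hl ih =>
      obtain ⟨K, hK, hK0, hKi, hKl⟩ := ih
      rw [Nat.add_sub_cancel] at hKi
      have hp : 0 < s l / s (l + 1) := div_pos (hspos l) (hspos (l + 1))
      have hg : Measurable fun x : Fin l → unitInterval =>
          ∫⁻ y, K (Fin.snoc x y) ^ (s l / s (l + 1)) :=
        Measurable.lintegral_prod_right' (f := fun p : (Fin l → unitInterval) × unitInterval =>
          K (Fin.snoc p.1 p.2) ^ (s l / s (l + 1)))
          ((hK.comp (measurable_snoc l)).pow_const _)
      refine ⟨fun x => stableConst (s l) (s (l + 1)) *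
        ∫⁻ y, K (Fin.snoc x y) ^ (s l / s (l + 1)), hg.const_mul _, fun x => ?_, ?_, fun t => ?_⟩
      · refine mul_ne_zero (stableConst_pos (hspos l) _).ne' fun h => ?_
        have hm : Measurable fun y => K (Fin.snoc x y) ^ (s l / s (l + 1)) :=
          (hK.comp ((measurable_snoc l).comp measurable_prodMk_left)).pow_const _
        rw [lintegral_eq_zero_iff hm] at h
        obtain ⟨y, hy⟩ := h.exists
        rw [Pi.zero_apply, ENNReal.rpow_eq_zero_iff_of_pos hp] at hy
        exact hK0 _ hy
      · have hp1 : s (l - 1) / s l ≤ 1 := by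
          refine (div_le_one (hspos l)).2 ?_
          rcases l with _ | l
          · exact le_rfl
          · exact (hslt l (Nat.lt_of_succ_lt hl)).le
        have hp0 : 0 < s (l - 1) / s l := div_pos (hspos _) (hspos l)
        have hle : ∀ z : ℝ≥0∞, z ^ (s (l - 1) / s l) ≤ 1 + z := fun z => by
          rcases le_total z 1 with hz | hz
          · exact (ENNReal.rpow_le_one hz hp0.le).trans le_self_add
          · refine le_trans ?_ le_add_self
            simpa using ENNReal.rpow_le_rpow_of_exponent_le hz hp1
        refine ne_top_of_le_ne_top ?_ (lintegral_mono fun x => hle _)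
        rw [lintegral_add_left measurable_const, lintegral_const_mul _ hg,
          ← lintegral_snoc (hK.pow_const _)]
        exact ENNReal.add_ne_top.2 ⟨by simp,
          ENNReal.mul_ne_top (stableConst_ne_top (hspos l) (hslt l hl)) hKi⟩
      · rw [hKl t]
        have hζ : 0 < ζ ⟨l, hl⟩ := hsl l hl ▸ hspos l
        have h := lintegral_expNeg_level hu hUm hlaw hU huU hl hζ (hspos (l + 1)) hK t
        rw [h, hsl l hl]
  obtain ⟨K, hK, hK0, hKi, hKl⟩ := key 0 (Nat.zero_le r)
  rw [hsl 0 hr] at hKl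
  -- At the root the mark vector is empty, so `K` is a single number: the scale `c`.
  have hconst : ∀ x, K x = K default := fun x => congrArg K (Subsingleton.elim _ _)
  refine ⟨K default, hK0 _, ?_, fun t => ?_⟩
  · simp_rw [hconst] at hKi
    simpa [div_self (hspos 0).ne'] using hKi
  · rw [hKl t]
    simp_rw [hconst]
    have h : ∀ a ω, vertexProd u (Nat.zero_le r) a ω = 1 := fun a ω => by simp [vertexProd]
    simp_rw [h]
    simp

end Tree

/-! ### Moments of a one-sided stable variable. -/

/-- A bound for the second moment of the logarithm of a variable with Laplace transform
`t ↦ exp (-t ^ a)`. -/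
noncomputable def logMomentBound (a : ℝ) : ℝ≥0∞ :=
  ENNReal.ofReal (16 / a ^ 2) * (stableConst (a / 2) a / stableConst (a / 2) 1) +
    4 * ∫⁻ t in Set.Ioi (0 : ℝ), expNeg (ENNReal.ofReal t ^ a)

theorem lintegral_expNeg_rpow_ne_top {a : ℝ} (ha : 0 < a) :
    ∫⁻ t in Set.Ioi (0 : ℝ), expNeg (ENNReal.ofReal t ^ a) ≠ ∞ := by
  have h := (integrableOn_rpow_mul_exp_neg_rpow (p := a) (s := 0) (by norm_num) ha
    ).lintegral_lt_top.ne
  refine ne_of_eq_of_ne (setLIntegral_congr_fun measurableSet_Ioi fun t ht => ?_) h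
  have ht : 0 < t := ht
  simp only [Real.rpow_zero, one_mul]
  rw [ENNReal.ofReal_rpow_of_pos ht, expNeg_ofReal (by positivity)]

theorem logMomentBound_ne_top {a : ℝ} (ha : 0 < a) : logMomentBound a ≠ ∞ :=
  ENNReal.add_ne_top.2 ⟨ENNReal.mul_ne_top ENNReal.ofReal_ne_top
    (ENNReal.div_ne_top (stableConst_ne_top (half_pos ha) (half_lt_self ha))
      (stableConst_pos (half_pos ha) 1).ne'),
    ENNReal.mul_ne_top (by simp) (lintegral_expNeg_rpow_ne_top ha)⟩

theorem lintegral_expNeg_mul (x : ℝ≥0∞) :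
    ∫⁻ t in Set.Ioi (0 : ℝ), expNeg (ENNReal.ofReal t * x) = x⁻¹ := by
  rcases eq_or_ne x 0 with rfl | h0
  · simp
  rcases eq_or_ne x ∞ with rfl | ht
  · rw [ENNReal.inv_top, ← lintegral_zero (μ := volume.restrict (Set.Ioi (0 : ℝ)))]
    refine setLIntegral_congr_fun measurableSet_Ioi fun t ht => ?_
    have ht : 0 < t := ht
    simp [ENNReal.mul_top, ht]
  have hx : 0 < x.toReal := ENNReal.toReal_pos h0 ht
  have h1 : ∫⁻ t in Set.Ioi (0 : ℝ), expNeg (ENNReal.ofReal t * x)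
      = ∫⁻ t in Set.Ioi (0 : ℝ), ENNReal.ofReal (Real.exp (-x.toReal * t)) := by
    refine setLIntegral_congr_fun measurableSet_Ioi fun t ht' => ?_
    have ht' : 0 < t := ht'
    have hxt : ENNReal.ofReal t * x = ENNReal.ofReal (t * x.toReal) := by
      rw [ENNReal.ofReal_mul ht'.le, ENNReal.ofReal_toReal ht]
    rw [hxt, expNeg_ofReal (by positivity)]
    ring_nf
  rw [h1, ← ofReal_integral_eq_lintegral_ofReal (integrableOn_exp_mul_Ioi (by linarith) 0)
    (ae_of_all _ fun t => (Real.exp_pos _).le), integral_exp_mul_Ioi (by linarith)]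
  conv_rhs => rw [← ENNReal.ofReal_toReal ht, ← ENNReal.ofReal_inv_of_pos hx]
  congr 1
  simp

/-- The bounds `log x ≤ x ^ (a / 4) / (a / 4)` for `x ≥ 1` and `log x⁻¹ ≤ 2 (x⁻¹) ^ (1 / 2)` for `x
≤ 1`, squared. The power `a / 2` is below `a`, where a stable variable of index `a` still has
moments. -/
theorem sq_log_le {a x : ℝ} (ha : 0 < a) (hx : 0 < x) :
    Real.log x ^ 2 ≤ 16 / a ^ 2 * x ^ (a / 2) + 4 * x⁻¹ := by
  rcases le_total 1 x with h | h
  · have h1 := Real.log_le_rpow_div hx.le (show 0 < a / 4 by positivity)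
    have h2 : Real.log x ^ 2 ≤ (x ^ (a / 4) / (a / 4)) ^ 2 :=
      pow_le_pow_left₀ (Real.log_nonneg h) h1 2
    have h3 : (x ^ (a / 4) / (a / 4)) ^ 2 = 16 / a ^ 2 * x ^ (a / 2) := by
      rw [div_pow, ← Real.rpow_natCast, ← Real.rpow_mul hx.le]
      ring_nf
    have h4 : 0 < x⁻¹ := by positivity
    linarith
  · have hx' : 0 < x⁻¹ := by positivity
    have h1 := Real.log_le_rpow_div hx'.le (show (0 : ℝ) < 1 / 2 by positivity)
    have h2 : Real.log x⁻¹ ^ 2 ≤ ((x⁻¹) ^ (1 / 2 : ℝ) / (1 / 2)) ^ 2 :=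
      pow_le_pow_left₀ (Real.log_nonneg ((one_le_inv₀ hx).2 h)) h1 2
    have h3 : ((x⁻¹) ^ (1 / 2 : ℝ) / (1 / 2)) ^ 2 = 4 * x⁻¹ := by
      rw [div_pow, ← Real.rpow_natCast, ← Real.rpow_mul hx'.le]
      norm_num
      ring
    rw [Real.log_inv, neg_sq] at h2
    have h4 : 0 ≤ 16 / a ^ 2 * x ^ (a / 2) := by positivity
    linarith

section Moments

variable {Ω : Type*} [MeasurableSpace Ω] {P : Measure Ω} [IsProbabilityMeasure P] {a : ℝ}
  {S : Ω → ℝ≥0∞}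

/-- `S ^ p` is, up to `stableConst p 1`, the integral of `1 - exp (-S x)` against the intensity of
index `p`; by Fubini only the Laplace transform of `S` is needed. -/
theorem lintegral_rpow_of_laplace (hS : Measurable S)
    (h : ∀ t : ℝ≥0∞, ∫⁻ ω, expNeg (t * S ω) ∂P = expNeg (t ^ a)) {p : ℝ} (hp : 0 < p)
    (hp1 : p < 1) : ∫⁻ ω, S ω ^ p ∂P = stableConst p a / stableConst p 1 := by
  rw [ENNReal.eq_div_iff (stableConst_pos hp 1).ne' (stableConst_ne_top hp hp1), mul_comm,
    ← lintegral_mul_const _ (by fun_prop)]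
  have h1 : ∀ ω, S ω ^ p * stableConst p 1
      = ∫⁻ x, (1 - expNeg (S ω * ENNReal.ofReal x)) ∂stableIntensity p := fun ω => by
    have := lintegral_one_sub_expNeg_mul_rpow hp one_pos (S ω)
    simp only [ENNReal.rpow_one, div_one] at this
    exact this.symm
  simp_rw [h1]
  rw [lintegral_lintegral_swap (by fun_prop), stableConst]
  refine lintegral_congr fun x => ?_
  have h2 : ∫⁻ ω, expNeg (S ω * ENNReal.ofReal x) ∂P = expNeg (ENNReal.ofReal x ^ a) := by
    rw [← h]
    simp_rw [mul_comm]
  rw [lintegral_sub (by fun_prop) (h2 ▸ expNeg_ne_top _) (ae_of_all _ fun ω => expNeg_le_one _),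
    h2]
  simp

/-- Fubini for `S⁻¹ = ∫ exp (-t S) dt` over `t > 0`. -/
theorem lintegral_inv_of_laplace (hS : Measurable S)
    (h : ∀ t : ℝ≥0∞, ∫⁻ ω, expNeg (t * S ω) ∂P = expNeg (t ^ a)) :
    ∫⁻ ω, (S ω)⁻¹ ∂P = ∫⁻ t in Set.Ioi (0 : ℝ), expNeg (ENNReal.ofReal t ^ a) := by
  simp_rw [← lintegral_expNeg_mul, ← h]
  exact lintegral_lintegral_swap (by fun_prop)

theorem lintegral_sq_log_le_of_laplace (ha : 0 < a) (ha1 : a < 1) (hS : Measurable S)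
    (h : ∀ t : ℝ≥0∞, ∫⁻ ω, expNeg (t * S ω) ∂P = expNeg (t ^ a)) :
    (∀ᵐ ω ∂P, S ω ≠ 0 ∧ S ω ≠ ∞) ∧
      ∫⁻ ω, ENNReal.ofReal (Real.log (S ω).toReal ^ 2) ∂P ≤ logMomentBound a := by
  have h1 := lintegral_rpow_of_laplace hS h (half_pos ha) (by linarith)
  have h2 := lintegral_inv_of_laplace hS h
  have hae : ∀ᵐ ω ∂P, S ω ≠ 0 ∧ S ω ≠ ∞ := by
    have h3 := ae_lt_top' (f := fun ω => S ω ^ (a / 2)) (by fun_prop) (h1 ▸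
      ENNReal.div_ne_top (stableConst_ne_top (half_pos ha) (half_lt_self ha))
        (stableConst_pos (half_pos ha) 1).ne')
    have h4 := ae_lt_top' (f := fun ω => (S ω)⁻¹) (by fun_prop)
      (h2 ▸ lintegral_expNeg_rpow_ne_top ha)
    filter_upwards [h3, h4] with ω h3 h4
    refine ⟨fun h => ?_, fun h => ?_⟩
    · simp [h] at h4
    · simp [h, ENNReal.top_rpow_of_pos (half_pos ha)] at h3
  refine ⟨hae, ?_⟩
  rw [logMomentBound, ← h1, ← h2, ← lintegral_const_mul _ (by fun_prop),
    ← lintegral_const_mul _ (by fun_prop), ← lintegral_add_left (by fun_prop)]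
  refine lintegral_mono_ae ?_
  filter_upwards [hae] with ω hω
  have hpos := ENNReal.toReal_pos hω.1 hω.2
  refine (ENNReal.ofReal_le_ofReal (sq_log_le ha hpos)).trans (le_of_eq ?_)
  rw [ENNReal.ofReal_add (by positivity) (by positivity), ENNReal.ofReal_mul (by positivity),
    ENNReal.ofReal_mul (by norm_num), ← ENNReal.ofReal_rpow_of_pos hpos,
    ENNReal.ofReal_inv_of_pos hpos, ENNReal.ofReal_toReal hω.2]
  simp

/-- The logarithm of a one-sided stable variable is in `L²`, with a bound for its distance to a
constant which does not depend on the scale. -/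
theorem exists_lintegral_sq_log_sub_le (ha : 0 < a) (ha1 : a < 1) (hS : Measurable S) {c : ℝ≥0∞}
    (hc0 : c ≠ 0) (hc : c ≠ ∞)
    (h : ∀ t : ℝ≥0∞, ∫⁻ ω, expNeg (t * S ω) ∂P = expNeg (c * t ^ a)) :
    (∀ᵐ ω ∂P, S ω ≠ 0 ∧ S ω ≠ ∞) ∧
      ∃ b : ℝ, ∫⁻ ω, ENNReal.ofReal ((Real.log (S ω).toReal - b) ^ 2) ∂P ≤ logMomentBound a := by
  -- The scale for which `d * S` has transform `expNeg (t ^ a)`; it becomes the additive constant `b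
  -- = -log d`.
  set d : ℝ≥0∞ := c ^ (-a⁻¹) with hd
  have hd0 : d ≠ 0 := (ENNReal.rpow_pos (pos_iff_ne_zero.2 hc0) hc).ne'
  have hdt : d ≠ ∞ := ENNReal.rpow_ne_top_of_ne_zero hc0 hc
  have hcd : c * d ^ a = 1 := by
    rw [hd, ← ENNReal.rpow_mul, neg_mul, inv_mul_cancel₀ ha.ne', ENNReal.rpow_neg_one,
      ENNReal.mul_inv_cancel hc0 hc]
  obtain ⟨h1, h2⟩ := lintegral_sq_log_le_of_laplace (S := fun ω => d * S ω) ha ha1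
    (hS.const_mul d) fun t => by
      simp_rw [← mul_assoc]
      rw [h, ENNReal.mul_rpow_of_nonneg _ _ ha.le, mul_comm (t ^ a), ← mul_assoc, hcd, one_mul]
  have h3 : ∀ᵐ ω ∂P, S ω ≠ 0 ∧ S ω ≠ ∞ := by
    filter_upwards [h1] with ω hω
    refine ⟨fun h => hω.1 (by simp [h]), fun h => hω.2 (by simp [h, hd0])⟩
  refine ⟨h3, -Real.log d.toReal, le_of_eq_of_le (lintegral_congr_ae ?_) h2⟩
  filter_upwards [h3] with ω hω
  rw [ENNReal.toReal_mul, Real.log_mul (ENNReal.toReal_pos hd0 hdt).ne'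
    (ENNReal.toReal_pos hω.1 hω.2).ne']
  ring_nf

end Moments

/-! ### Positivity, variance, and the main theorem. -/

/-- The number of points in `(-∞, 0]` has Laplace transform `1`, hence vanishes almost surely. This
identifies the products truncated by `ENNReal.ofReal` with the real ones. -/
theorem ae_pos_of_isPoissonProcess {Ω : Type*} [MeasurableSpace Ω] {P : Measure Ω}
    [IsProbabilityMeasure P] {a : ℝ} {u : ℕ → Ω → ℝ}
    (hanti : ∀ᵐ ω ∂P, StrictAnti (fun n => u n ω))
    (hP : IsPoissonProcess (stableIntensity a) (fun ω => Set.range (fun n => u n ω)) P) :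
    ∀ᵐ ω ∂P, ∀ n, 0 < u n ω := by
  have h := lintegral_expNeg_count (hanti.mono fun ω h => h.injective) hP
    (measurableSet_Iic (a := (0 : ℝ))) (by simp [stableIntensity_Iic]) 1
  rw [stableIntensity_Iic, zero_mul, expNeg_zero] at h
  have h1 := ae_eq_of_ae_le_of_lintegral_le (ae_of_all P fun ω => expNeg_le_one _)
    (by rw [h]; simp) (aemeasurable_const (b := (1 : ℝ≥0∞))) (by rw [h]; simp)
  filter_upwards [h1] with ω hω n
  have h2 := expNeg_injective (hω.trans expNeg_zero.symm)
  rw [one_mul, ENNReal.tsum_eq_zero] at h2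
  by_contra hn
  have h3 := h2 n
  have h4 : u n ω ∈ Set.Iic (0 : ℝ) := not_lt.1 hn
  rw [Set.indicator_of_mem h4] at h3
  simp at h3

/-- Variance ignores the shift by `b` and is at most the second moment, so no control of `b` is
needed. -/
theorem memLp_and_integral_sq_le {Ω : Type*} [MeasurableSpace Ω] {P : Measure Ω}
    [IsProbabilityMeasure P] {φ : Ω → ℝ} (hφ : AEStronglyMeasurable φ P) (b : ℝ) {B : ℝ≥0∞}
    (hB : B ≠ ∞) (h : ∫⁻ ω, ENNReal.ofReal ((φ ω - b) ^ 2) ∂P ≤ B) :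
    MemLp φ 2 P ∧ ∫ ω, (φ ω - ∫ ω', φ ω' ∂P) ^ 2 ∂P ≤ B.toReal := by
  have hm : AEStronglyMeasurable (fun ω => φ ω - b) P := hφ.sub aestronglyMeasurable_const
  have hint : Integrable (fun ω => (φ ω - b) ^ 2) P :=
    (lintegral_ofReal_ne_top_iff_integrable (hm.pow 2) (ae_of_all _ fun ω => sq_nonneg _)).1
      (ne_top_of_le_ne_top hB h)
  constructor
  · have := ((memLp_two_iff_integrable_sq hm).2 hint).add (memLp_const b)
    refine this.ae_eq (ae_of_all _ fun ω => ?_)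
    simp
  · rw [← variance_eq_integral hφ.aemeasurable, ← variance_sub_const hφ b]
    refine (variance_le_expectation_sq hm).trans ?_
    have := integral_eq_lintegral_of_nonneg_ae (ae_of_all P fun ω => sq_nonneg (φ ω - b)) (hm.pow 2)
    change ∫ ω, (φ ω - b) ^ 2 ∂P ≤ _
    rw [this]
    exact ENNReal.toReal_mono hB h

theorem ofReal_sub_sq_le (x y : ℝ) :
    ENNReal.ofReal ((x - y) ^ 2) ≤ 2 * ENNReal.ofReal (x ^ 2) + 2 * ENNReal.ofReal (y ^ 2) := by
  have h : (2 : ℝ≥0∞) = ENNReal.ofReal 2 := by simp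
  rw [h, ← ENNReal.ofReal_mul zero_le_two, ← ENNReal.ofReal_mul zero_le_two,
    ← ENNReal.ofReal_add (by positivity) (by positivity)]
  exact ENNReal.ofReal_le_ofReal (by nlinarith [sq_nonneg (x + y)])

theorem mainTheorem5 :
    ∃ c : ℝ → ℝ, ∀ (r : ℕ) (hr : 1 ≤ r) (ζ : Fin r → ℝ), StrictMono ζ →
      0 < ζ ⟨0, hr⟩ → ζ ⟨r - 1, Nat.sub_lt hr Nat.one_pos⟩ < 1 →
      ∀ (Ω : Type*) [MeasurableSpace Ω] (P : Measure Ω) [IsProbabilityMeasure P]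
        (u : InnerVertex r → ℕ → Ω → ℝ) (U : InnerVertex r → ℕ → Ω → unitInterval)
        (X : (Fin r → unitInterval) → ℝ),
        -- `u` generates the cascade, the marks `U` are i.i.d. uniform on `[0, 1]` and
        -- independent of the cascade
        IsCascadePoints ζ u P →
        (∀ a n, Measurable (U a n)) →
        (∀ a n, HasLaw (U a n) volume P) →
        iIndepFun (fun (v : InnerVertex r × ℕ) (ω : Ω) => U v.1 v.2 ω) P →
        IndepFun (fun (ω : Ω) (v : InnerVertex r × ℕ) => u v.1 v.2 ω)
          (fun (ω : Ω) (v : InnerVertex r × ℕ) => U v.1 v.2 ω) P →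
        Measurable X →
        Integrable (fun x => Real.exp (ζ ⟨r - 1, Nat.sub_lt hr Nat.one_pos⟩ * X x)) volume →
        (∀ᵐ ω ∂P, Summable (fun α : Fin r → ℕ => cascadeProd u α ω)) ∧
        (∀ᵐ ω ∂P, Summable (fun α : Fin r → ℕ =>
          cascadeWeight u α ω * Real.exp (X (pathMarks U α ω)))) ∧
        MemLp (cascadePhi u U X) 2 P ∧
        ∫ ω, (cascadePhi u U X ω - ∫ ω', cascadePhi u U X ω' ∂P) ^ 2 ∂P ≤ 4 * c (ζ ⟨0, hr⟩) := by
  refine ⟨fun a => (logMomentBound a).toReal, ?_⟩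
  intro r hr ζ hζ h0 h1 Ω _ P _ u U X hu hUm hlaw hU huU hX hXi
  have hum := hu.measurable
  have h01 : ζ ⟨0, hr⟩ < 1 :=
    (hζ.monotone (Fin.mk_le_mk.2 (Nat.zero_le (r - 1)))).trans_lt h1
  let T : Ω → ℝ≥0∞ := fun ω =>
    ∑' α, ENNReal.ofReal (Real.exp (X (vertexMarks U le_rfl α ω))) * vertexProd u le_rfl α ω
  -- The factor `1` makes `Z` an instance of the same lemma, with weight function `1`.
  let Z : Ω → ℝ≥0∞ := fun ω => ∑' α, 1 * vertexProd u le_rfl α ω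
  have hWm : ∀ α, Measurable fun ω => vertexProd u le_rfl α ω := fun α => by
    unfold vertexProd
    fun_prop
  have hMm : ∀ α, Measurable fun ω => vertexMarks U le_rfl α ω := fun α =>
    measurable_pi_lambda _ fun i => hUm _ _
  have hTm : Measurable T := by fun_prop
  have hZm : Measurable Z := by fun_prop
  obtain ⟨cT, hcT0, hcT, hLT⟩ := exists_laplace_cascade hr hζ h0 h1 hu hUm hlaw hU huU
    (f := fun x => ENNReal.ofReal (Real.exp (X x))) (by fun_prop)
    (fun x => by simpa using Real.exp_pos _) (by
      refine ne_of_eq_of_ne (lintegral_congr fun x => ?_) hXi.lintegral_lt_top.ne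
      rw [ENNReal.ofReal_rpow_of_pos (Real.exp_pos _), ← Real.exp_mul, mul_comm])
  obtain ⟨cZ, hcZ0, hcZ, hLZ⟩ := exists_laplace_cascade hr hζ h0 h1 hu hUm hlaw hU huU
    (f := fun _ => 1) measurable_const (fun _ => one_ne_zero) (by simp)
  obtain ⟨hT, bT, hbT⟩ := exists_lintegral_sq_log_sub_le h0 h01 hTm hcT0 hcT hLT
  obtain ⟨hZ, bZ, hbZ⟩ := exists_lintegral_sq_log_sub_le h0 h01 hZm hcZ0 hcZ hLZ
  have hpos : ∀ᵐ ω ∂P, ∀ a n, 0 < u a n ω := ae_all_iff.2 fun a =>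
    ae_pos_of_isPoissonProcess (hu.strictAnti a) (hu.isPoissonProcess a)
  have hprod : ∀ ω, (∀ a n, 0 < u a n ω) → ∀ α : Fin r → ℕ,
      (vertexProd u le_rfl α ω).toReal = cascadeProd u α ω := fun ω hω α => by
    unfold vertexProd cascadeProd
    rw [← ENNReal.ofReal_prod_of_nonneg fun i _ => (hω _ _).le,
      ENNReal.toReal_ofReal (Finset.prod_nonneg fun i _ => (hω _ _).le)]
    rfl
  have hterm : ∀ ω, (∀ a n, 0 < u a n ω) → ∀ α : Fin r → ℕ,
      (ENNReal.ofReal (Real.exp (X (vertexMarks U le_rfl α ω))) *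
        vertexProd u le_rfl α ω).toReal
        = cascadeProd u α ω * Real.exp (X (pathMarks U α ω)) := fun ω hω α => by
    rw [ENNReal.toReal_mul, hprod ω hω, ENNReal.toReal_ofReal (Real.exp_pos _).le, mul_comm]
    rfl
  have hweight : ∀ ω, (fun α : Fin r → ℕ => cascadeWeight u α ω * Real.exp (X (pathMarks U α ω)))
      = fun α => (cascadeProd u α ω * Real.exp (X (pathMarks U α ω))) *
        (∑' β : Fin r → ℕ, cascadeProd u β ω)⁻¹ := fun ω => by
    funext α
    unfold cascadeWeight
    ring
  have hφ : ∀ᵐ ω ∂P, cascadePhi u U X ω = Real.log (T ω).toReal - Real.log (Z ω).toReal := by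
    filter_upwards [hT, hZ, hpos] with ω hTω hZω hω
    have hTr : (T ω).toReal = ∑' α, cascadeProd u α ω * Real.exp (X (pathMarks U α ω)) := by
      rw [ENNReal.tsum_toReal_eq fun α => ENNReal.ne_top_of_tsum_ne_top hTω.2 α]
      exact tsum_congr (hterm ω hω)
    have hZr : (Z ω).toReal = ∑' α, cascadeProd u α ω := by
      rw [ENNReal.tsum_toReal_eq fun α => ENNReal.ne_top_of_tsum_ne_top hZω.2 α]
      exact tsum_congr fun α => by rw [one_mul, hprod ω hω]
    rw [cascadePhi, hweight, tsum_mul_right, ← hTr, ← hZr, Real.log_mul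
      (ENNReal.toReal_pos hTω.1 hTω.2).ne' (inv_ne_zero (ENNReal.toReal_pos hZω.1 hZω.2).ne'),
      Real.log_inv, sub_eq_add_neg]
  refine ⟨?_, ?_, ?_⟩
  · filter_upwards [hZ, hpos] with ω hZω hω
    refine (ENNReal.summable_toReal hZω.2).congr fun α => ?_
    rw [one_mul, hprod ω hω]
  · filter_upwards [hT, hpos] with ω hTω hω
    rw [hweight]
    exact ((ENNReal.summable_toReal hTω.2).congr (hterm ω hω)).mul_right _
  have hφm : AEStronglyMeasurable (cascadePhi u U X) P :=
    (Measurable.aestronglyMeasurable (by fun_prop)).congr (hφ.mono fun ω h => h.symm)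
  -- Since `(x - y)² ≤ 2 x² + 2 y²`, the two logarithms contribute twice the bound each; hence the
  -- factor `4`.
  have hbound : ∫⁻ ω, ENNReal.ofReal ((cascadePhi u U X ω - (bT - bZ)) ^ 2) ∂P
      ≤ 4 * logMomentBound (ζ ⟨0, hr⟩) := by
    calc ∫⁻ ω, ENNReal.ofReal ((cascadePhi u U X ω - (bT - bZ)) ^ 2) ∂P
        ≤ ∫⁻ ω, (2 * ENNReal.ofReal ((Real.log (T ω).toReal - bT) ^ 2) +
            2 * ENNReal.ofReal ((Real.log (Z ω).toReal - bZ) ^ 2)) ∂P := by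
          refine lintegral_mono_ae (hφ.mono fun ω h => ?_)
          rw [h, sub_sub_sub_comm]
          exact ofReal_sub_sq_le _ _
      _ ≤ 2 * logMomentBound (ζ ⟨0, hr⟩) + 2 * logMomentBound (ζ ⟨0, hr⟩) := by
          rw [lintegral_add_left (by fun_prop), lintegral_const_mul _ (by fun_prop),
            lintegral_const_mul _ (by fun_prop)]
          gcongr
      _ = 4 * logMomentBound (ζ ⟨0, hr⟩) := by
          rw [← add_mul]
          norm_num
  have h := memLp_and_integral_sq_le hφm _
    (ENNReal.mul_ne_top (by simp) (logMomentBound_ne_top h0)) hbound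
  rw [ENNReal.toReal_mul] at h
  simpa using h
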